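/- Let $X$ be a complex manifold (Hausdorff, second countable) of complex dimension $n \ge 2$, and let $M \subset X$ be a nonsingular real analytic hypersurface: near each of its points, $M$ is the zero locus of a real-valued real analytic function $\rho$ with nonvanishing gradient ($M$ need not be closed in $X$). Suppose that $M$ is Levi-flat, i.e. its Levi form vanishes identically: near each point of $M$ there is such a $\rho$, defined in holomorphic coordinates $z_1,\dots,z_n$, with $$\sum_{j,k=1}^n \frac{\partial^2\rho}{\partial z_j\,\partial\bar z_k}(p)\,w_j\overline{w}_k = 0$$ for all nearby $p \in M$ and all $w \in H_pM = T_pM\cap J\,T_pM$, where $J$ is the complex structure of $X$. Let $\mathcal L$ be the Levi foliation of $M$, i.e. the foliation of $M$ by complex hypersurfaces; its leaf through $p\in M$ consists of the points that can be joined to $p$ by a finite chain of connected nonsingular complex hypersurfaces of $X$ (locally closed complex submanifolds of codimension one), each contained in $M$ and meeting the next. Then $\mathcal L$ extends to a nonsingular holomorphic foliation of a neighbourhood of $M$: there exist an open set $V\subset X$ with $M\subset V$ and a nonsingular holomorphic foliation $\mathcal F$ of codimension one on $V$ such that, for every $p\in M$, the leaf of $\mathcal F$ through $p$ is the leaf of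 $\mathcal L$ through $p$. Here $\mathcal F$ is given by an atlas of biholomorphic charts from open sets covering $V$ onto the polydisc $D^{n-1}\times D\subset\mathbb C^{n-1}\times\mathbb C$ ($D$ the unit disc) whose transition maps are locally of the form $h(x,y)=(h_1(x,y),h_2(y))$; its plaques are the preimages of the sets $D^{n-1}\times\{y\}$, and its leaves consist of the points that can be joined by finite chains of plaques. -/

import Mathlib

open Set Topology
open scoped Manifold ContDiff ComplexConjugate

noncomputable section

namespace LeviFlat

/-- Complex coordinate space `ℂⁿ`. -/
abbrev Cn (n : ℕ) : Type := EuclideanSpace ℂ (Fin n)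

/-- The vector `∂/∂xⱼ`, i.e. the `j`-th coordinate vector of `ℂⁿ`; the vector `∂/∂yⱼ` is
`Complex.I • coordVec n j`. -/
def coordVec (n : ℕ) (j : Fin n) : Cn n := EuclideanSpace.single j (1 : ℂ)

/-- The Wirtinger derivative `∂u/∂zⱼ = (∂u/∂xⱼ - i ∂u/∂yⱼ) / 2`. -/
def dz {n : ℕ} (j : Fin n) (u : Cn n → ℂ) (z : Cn n) : ℂ :=
  (fderiv ℝ u z (coordVec n j) - Complex.I * fderiv ℝ u z (Complex.I • coordVec n j)) / 2

/-- The Wirtinger derivative `∂u/∂z̄ⱼ = (∂u/∂xⱼ + i ∂u/∂yⱼ) / 2`. -/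
def dzbar {n : ℕ} (j : Fin n) (u : Cn n → ℂ) (z : Cn n) : ℂ :=
  (fderiv ℝ u z (coordVec n j) + Complex.I * fderiv ℝ u z (Complex.I • coordVec n j)) / 2

/-- The Hermitian quadratic form `∑ⱼₖ ∂²r/∂zⱼ∂z̄ₖ (z) wⱼ w̄ₖ` of a real-valued function `r`. -/
def leviForm {n : ℕ} (r : Cn n → ℝ) (z w : Cn n) : ℂ :=
  ∑ j, ∑ k, dz j (dzbar k (fun ζ => (r ζ : ℂ))) z * w j * conj (w k)

/-- The complex tangent space `H = T ∩ J T` at `z` of the real hypersurface `{r = 0}`, where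
`T = ker dr(z)` and `J` is multiplication by `i`. -/
def complexTangent {n : ℕ} (r : Cn n → ℝ) (z : Cn n) : Set (Cn n) :=
  {w | fderiv ℝ r z w = 0 ∧ fderiv ℝ r z (Complex.I • w) = 0}

section Manifold

variable {n : ℕ} {X : Type*} [TopologicalSpace X]

/-- In the coordinates `e`, the set `M` is given on the open set `W` as the zero locus of the
real analytic real-valued function `r`, whose gradient does not vanish along the zero locus. -/
structure IsDefiningFunction (M : Set X) (e : OpenPartialHomeomorph X (Cn n))
    (W : Set (Cn n)) (r : Cn n → ℝ) : Prop where
  isOpen : IsOpen W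
  subset_target : W ⊆ e.target
  analytic : AnalyticOnNhd ℝ r W
  gradient_ne_zero : ∀ z ∈ W, r z = 0 → fderiv ℝ r z ≠ 0
  mem_iff : ∀ z ∈ W, (e.symm z ∈ M ↔ r z = 0)

variable (n) [ChartedSpace (Cn n) X]

/-- `M` is a nonsingular real analytic hypersurface of the complex manifold `X` of dimension `n`
(not necessarily closed in `X`). -/
def IsRealAnalyticHypersurface (M : Set X) : Prop :=
  ∀ p ∈ M, ∃ (W : Set (Cn n)) (r : Cn n → ℝ),
    IsDefiningFunction M (chartAt (Cn n) p) W r ∧ chartAt (Cn n) p p ∈ W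

/-- The Levi form of the real analytic hypersurface `M` vanishes identically: near every point,
`M` has a local defining function whose Levi form is zero on the complex tangent spaces of `M`. -/
def IsLeviFlat (M : Set X) : Prop :=
  ∀ p ∈ M, ∃ (W : Set (Cn n)) (r : Cn n → ℝ),
    IsDefiningFunction M (chartAt (Cn n) p) W r ∧ chartAt (Cn n) p p ∈ W ∧
      ∀ z ∈ W, r z = 0 → ∀ w ∈ complexTangent r z, leviForm r z w = 0

/-- `S` is a nonsingular complex hypersurface (a locally closed complex submanifold of
codimension one) of `X`: near each of its points it is the zero locus of a holomorphic function
with nonvanishing differential. -/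
def IsComplexHypersurface (S : Set X) : Prop :=
  ∀ p ∈ S, ∃ (W : Set (Cn n)) (f : Cn n → ℂ),
    IsOpen W ∧ W ⊆ (chartAt (Cn n) p).target ∧ chartAt (Cn n) p p ∈ W ∧
      DifferentiableOn ℂ f W ∧ (∀ z ∈ W, f z = 0 → fderiv ℂ f z ≠ 0) ∧
      ∀ z ∈ W, ((chartAt (Cn n) p).symm z ∈ S ↔ f z = 0)

/-- The points `a` and `b` lie on a common connected complex hypersurface contained in `M`. -/
def LeviPlaqueRel (M : Set X) (a b : X) : Prop :=
  ∃ S : Set X, S ⊆ M ∧ IsComplexHypersurface n S ∧ IsConnected S ∧ a ∈ S ∧ b ∈ S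

/-- The leaf through `p` of the Levi foliation, the foliation of the Levi-flat hypersurface `M`
by complex hypersurfaces: all points that can be reached from `p` by a finite chain of connected
complex hypersurfaces contained in `M`. (The tangent spaces of a complex hypersurface contained
in `M` are the complex tangent spaces of `M`, so these hypersurfaces are exactly the connected
embedded integral manifolds of the complex tangent distribution of maximal dimension.) -/
def leviLeaf (M : Set X) (p : X) : Set X :=
  {q | Relation.EqvGen (LeviPlaqueRel n M) p q}

/-- A (nonsingular) holomorphic foliation of codimension one on the subset `V` of the complex
manifold `X` of dimension `n`, given by an atlas of foliated charts: biholomorphic maps onto the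
unit polydisc `Dⁿ⁻¹ × D` such that the transition maps are locally of the form
`h(x, y) = (h₁(x, y), h₂(y))`. -/
structure HolomorphicFoliation (V : Set X) where
  charts : Set (OpenPartialHomeomorph X ((Fin (n - 1) → ℂ) × ℂ))
  source_subset : ∀ φ ∈ charts, φ.source ⊆ V
  cover : ∀ x ∈ V, ∃ φ ∈ charts, x ∈ φ.source
  target_eq : ∀ φ ∈ charts,
    φ.target = Metric.ball (0 : Fin (n - 1) → ℂ) 1 ×ˢ Metric.ball (0 : ℂ) 1
  holomorphic : ∀ φ ∈ charts,
    ContMDiffOn 𝓘(ℂ, Cn n) 𝓘(ℂ, (Fin (n - 1) → ℂ) × ℂ) ω φ φ.source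
  holomorphic_symm : ∀ φ ∈ charts,
    ContMDiffOn 𝓘(ℂ, (Fin (n - 1) → ℂ) × ℂ) 𝓘(ℂ, Cn n) ω φ.symm φ.target
  transition : ∀ φ ∈ charts, ∀ ψ ∈ charts, ∀ x ∈ φ.source ∩ ψ.source,
    ∃ h₂ : ℂ → ℂ, ∀ᶠ z in 𝓝 (φ x), (ψ (φ.symm z)).2 = h₂ z.2

variable {n}

/-- The points `a` and `b` lie on a common plaque `φ⁻¹(Dⁿ⁻¹ × {y})` of the foliation. -/
def HolomorphicFoliation.PlaqueRel {V : Set X} (F : HolomorphicFoliation n V) (a b : X) : Prop :=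
  ∃ φ ∈ F.charts, a ∈ φ.source ∧ b ∈ φ.source ∧ (φ a).2 = (φ b).2

/-- The leaf of the foliation through the point `p` of `V`: all points that can be reached from
`p` by a finite chain of plaques. -/
def HolomorphicFoliation.leaf {V : Set X} (F : HolomorphicFoliation n V) (p : X) : Set X :=
  {q | Relation.EqvGen F.PlaqueRel p q}

/-- The foliation `F` extends the Levi foliation of `M`: through every point of `M`, the leaf of
`F` is the leaf of the Levi foliation. -/
def HolomorphicFoliation.ExtendsLeviFoliation {V : Set X} (F : HolomorphicFoliation n V)
    (M : Set X) : Prop :=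
  ∀ p ∈ M, F.leaf p = leviLeaf n M p

end Manifold

end LeviFlat

end

/-! Locally, the problem is to write `M` as `{Im G = 0}` with `G` a holomorphic submersion. The real
analytic defining function `r` is polarized to a holomorphic `R(z, w)` with `R(z, z̄) = r(z)`.
Vanishing of the Levi form says that the mixed Hessian of `R` vanishes on the kernels of its two
partial differentials at real points `w = z̄` of `{R = 0}`. These points are maximally totally real
in the complex hypersurface `{R = 0}`, so the condition holds on all of it near the base point
(`eventually_mixedHessianVanishes`).

The condition forces the kernel of `∂_w R` to be constant along each Segre variety `{R(·, w) = 0}`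
(`segre_conormal_const`). Consequently a function `b(w)`, read off at `z = z₀`, is constant on each
`{R(z, ·) = 0}`, and `R = 0` implies `b(w) = g(z)` (`exists_separation`). On `M`, Hermitian symmetry
of `R` turns `b(z̄)` into the conjugate of a holomorphic `σ(z)`, so `g = σ̄` there. Both `σ + g` and
`i(σ - g)` are then real on `M`, and one of them is a submersion since `dσ ≠ 0`
(`exists_holomorphic_flattening`).

Globally, completing `G` to coordinates gives flat charts `(x, y)` in which `M = {Im y = 0}`. The
last coordinate of one flat chart, seen in a polydisc of another, is real for real `y`, hence
independent of `x` for real `y`, hence for all `y` (`IsFlatChart.exists_eq_comp_snd`). This needs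
the whole polydisc to lie in the other chart, which is arranged by taking polydiscs small in a
metric on `X`. The same principle, that real-valued holomorphic functions are locally constant, puts
complex hypersurfaces inside `M` into plaques, so the leaves agree
(`HolomorphicFoliation.extendsLeviFoliation`). -/

noncomputable section

namespace LeviFlat

open Filter

/-! ### Implicit functions in a transverse direction -/

section Implicit

variable {𝕜 : Type*} [RCLike 𝕜] {E : Type*} [NormedAddCommGroup E] [NormedSpace 𝕜 E]

/-- Implicit function theorem along a vector `v` transverse to `{f = 0}`. -/
theorem exists_implicit_along [CompleteSpace E] {k : ℕ∞ω} (hk : k ≠ 0) {f : E → 𝕜} {x v : E}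
    (hf : ContDiffAt 𝕜 k f x) (h0 : f x = 0) (hv : fderiv 𝕜 f x v ≠ 0) :
    ∃ T : E → 𝕜, ContDiffAt 𝕜 k T x ∧ T x = 0 ∧
      ∀ᶠ q : E × 𝕜 in 𝓝 (x, 0), f (q.1 + q.2 • v) = 0 ↔ T q.1 = q.2 := by
  set F : E × 𝕜 → 𝕜 := fun q => f (q.1 + q.2 • v) with hF
  set A : E × 𝕜 →L[𝕜] E :=
    ContinuousLinearMap.fst 𝕜 E 𝕜 + (ContinuousLinearMap.snd 𝕜 E 𝕜).smulRight v
  have hpt : A (x, 0) = x := by simp [A]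
  have hcd : ContDiffAt 𝕜 k F (x, 0) :=
    ContDiffAt.comp (g := f) (f := A) (x, (0 : 𝕜)) (by rwa [hpt]) A.contDiff.contDiffAt
  have hF0 : F (x, 0) = 0 := by simp [hF, h0]
  have hder : HasFDerivAt F ((fderiv 𝕜 f x).comp A) (x, 0) := by
    refine HasFDerivAt.comp (g := f) (f := A) (x, (0 : 𝕜)) ?_ A.hasFDerivAt
    rw [hpt]
    exact (hf.differentiableAt hk).hasFDerivAt
  have hinv : (fderiv 𝕜 F (x, 0) ∘L .inr 𝕜 E 𝕜).IsInvertible := by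
    refine ⟨ContinuousLinearEquiv.unitsEquivAut 𝕜 (Units.mk0 _ hv), ?_⟩
    ext
    simp [hder.fderiv, A]
  refine ⟨hcd.implicitFunction hk hinv, hcd.contDiffAt_implicitFunction hk hinv,
    hcd.implicitFunction_apply_self hk hinv, ?_⟩
  simpa only [hF0] using hcd.eventually_apply_eq_iff_implicitFunction hk hinv

theorem eventually_apply_implicit_along {f T : E → 𝕜} {x v : E} (hT : ContinuousAt T x)
    (hT0 : T x = 0)
    (h : ∀ᶠ q : E × 𝕜 in 𝓝 (x, 0), f (q.1 + q.2 • v) = 0 ↔ T q.1 = q.2) :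
    ∀ᶠ y in 𝓝 x, f (y + T y • v) = 0 := by
  have : Tendsto (fun y => (y, T y)) (𝓝 x) (𝓝 (x, 0)) := by
    have := (continuousAt_id (x := x)).prodMk hT
    rwa [ContinuousAt, id, hT0] at this
  filter_upwards [this.eventually h] with y hy
  exact hy.2 rfl

theorem eventually_eq_zero_iff_implicit_along {f T : E → 𝕜} {x v : E}
    (h : ∀ᶠ q : E × 𝕜 in 𝓝 (x, 0), f (q.1 + q.2 • v) = 0 ↔ T q.1 = q.2) :
    ∀ᶠ y in 𝓝 x, f y = 0 ↔ T y = 0 := by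
  have : Tendsto (fun y => (y, (0 : 𝕜))) (𝓝 x) (𝓝 (x, 0)) :=
    (continuousAt_id (x := x)).prodMk continuousAt_const
  filter_upwards [this.eventually h] with y hy
  simpa using hy

end Implicit

/-! ### Complexification of real power series -/

section Complexification

variable {V E J : Type*} [NormedAddCommGroup V] [NormedSpace ℝ V] [NormedAddCommGroup E]
  [NormedSpace ℂ E] [Fintype J]

/-- The complexification, in coordinates, of a real multilinear map. -/
def complexifyMultilinear (b : J → V) (L : J → E →L[ℂ] ℂ) {k : ℕ} (p : V [×k]→L[ℝ] ℂ) :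
    E [×k]→L[ℂ] ℂ :=
  ∑ s : Fin k → J, p (fun i => b (s i)) •
    (ContinuousMultilinearMap.mkPiAlgebra ℂ (Fin k) ℂ).compContinuousLinearMap
      (fun i => L (s i))

theorem complexifyMultilinear_apply (b : J → V) (L : J → E →L[ℂ] ℂ) {k : ℕ}
    (p : V [×k]→L[ℝ] ℂ) (m : Fin k → E) :
    complexifyMultilinear b L p m =
      ∑ s : Fin k → J, p (fun i => b (s i)) * ∏ i, L (s i) (m i) := by
  simp [complexifyMultilinear]

/-- There are `card J ^ k` terms, each bounded separately. The loss is only geometric in `k`, so the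
complexified series keeps a positive radius of convergence. -/
theorem norm_complexifyMultilinear_le (b : J → V) (L : J → E →L[ℂ] ℂ) {B C : ℝ}
    (hB : ∀ j, ‖b j‖ ≤ B) (hC : ∀ j, ‖L j‖ ≤ C) (hB0 : 0 ≤ B) (hC0 : 0 ≤ C) {k : ℕ}
    (p : V [×k]→L[ℝ] ℂ) :
    ‖complexifyMultilinear b L p‖ ≤ ‖p‖ * (Fintype.card J * B * C) ^ k := by
  refine ContinuousMultilinearMap.opNorm_le_bound (by positivity) fun m => ?_
  rw [complexifyMultilinear_apply]
  calc ‖∑ s : Fin k → J, p (fun i => b (s i)) * ∏ i, L (s i) (m i)‖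
      ≤ ∑ _s : Fin k → J, (‖p‖ * B ^ k) * (C ^ k * ∏ i, ‖m i‖) := by
        refine norm_sum_le_of_le _ fun s _ => ?_
        rw [norm_mul, norm_prod]
        have h1 : ‖p (fun i => b (s i))‖ ≤ ‖p‖ * B ^ k := by
          refine (p.le_opNorm _).trans ?_
          gcongr
          calc ∏ i, ‖b (s i)‖ ≤ ∏ _i : Fin k, B :=
                Finset.prod_le_prod (fun _ _ => norm_nonneg _) fun i _ => hB _
            _ = B ^ k := by simp
        have h2 : ∏ i, ‖L (s i) (m i)‖ ≤ C ^ k * ∏ i, ‖m i‖ := by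
          calc ∏ i, ‖L (s i) (m i)‖ ≤ ∏ i, (C * ‖m i‖) :=
                Finset.prod_le_prod (fun _ _ => norm_nonneg _) fun i _ =>
                  ((L (s i)).le_opNorm _).trans (by gcongr; exact hC _)
            _ = C ^ k * ∏ i, ‖m i‖ := by simp [Finset.prod_mul_distrib]
        exact mul_le_mul h1 h2 (Finset.prod_nonneg fun _ _ => norm_nonneg _) (by positivity)
    _ = ‖p‖ * (Fintype.card J * B * C) ^ k * ∏ i, ‖m i‖ := by
        simp [Finset.sum_const, mul_pow]
        ring

/-- Expand each argument `x = ∑ ℓ j x • b j` by multilinearity; the coefficients are the values of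
`L j` at `ι x`. -/
theorem complexifyMultilinear_apply_real (b : J → V) (L : J → E →L[ℂ] ℂ) (ι : V → E)
    (ℓ : J → V → ℝ) (hb : ∀ x, ∑ j, ℓ j x • b j = x) (hL : ∀ j x, L j (ι x) = ℓ j x) {k : ℕ}
    (p : V [×k]→L[ℝ] ℂ) (x : V) :
    complexifyMultilinear b L p (fun _ => ι x) = p (fun _ => x) := by
  classical
  rw [complexifyMultilinear_apply]
  conv_rhs => rw [← hb x]
  rw [p.map_sum]
  refine Finset.sum_congr rfl fun s _ => ?_
  rw [p.map_smul_univ (fun i => ℓ (s i) x) (fun i => b (s i))]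
  simp [hL, mul_comm]

/-- A real analytic function extends to a holomorphic function on a neighbourhood in the
complexified space. -/
theorem exists_complexification (b : J → V) (L : J → E →L[ℂ] ℂ) (ι : V →ₗ[ℝ] E)
    (ℓ : J → V → ℝ) (hb : ∀ x, ∑ j, ℓ j x • b j = x) (hL : ∀ j x, L j (ι x) = ℓ j x)
    {f : V → ℂ} {x₀ : V} (hf : AnalyticAt ℝ f x₀) :
    ∃ R : E → ℂ, AnalyticAt ℂ R (ι x₀) ∧ ∀ᶠ x in 𝓝 x₀, R (ι x) = f x := by
  obtain ⟨p, r, hp⟩ := hf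
  obtain ⟨a, ha0, har⟩ := ENNReal.lt_iff_exists_nnreal_btwn.1 hp.radius_pos
  have ha0' : (0 : ℝ) < a := by exact_mod_cast ha0
  obtain ⟨C₀, -, hC₀⟩ := p.norm_mul_pow_le_of_lt_radius har
  set B : ℝ := ∑ j, ‖b j‖
  set C : ℝ := ∑ j, ‖L j‖
  have hB : ∀ j, ‖b j‖ ≤ B := fun j =>
    Finset.single_le_sum (f := fun j => ‖b j‖) (fun _ _ => norm_nonneg _) (Finset.mem_univ j)
  have hC : ∀ j, ‖L j‖ ≤ C := fun j =>
    Finset.single_le_sum (f := fun j => ‖L j‖) (fun _ _ => norm_nonneg _) (Finset.mem_univ j)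
  have hB0 : 0 ≤ B := Finset.sum_nonneg fun _ _ => norm_nonneg _
  have hC0 : 0 ≤ C := Finset.sum_nonneg fun _ _ => norm_nonneg _
  set A : ℝ := Fintype.card J * B * C
  have hA : 0 ≤ A := by positivity
  set q : FormalMultilinearSeries ℂ E ℂ := fun k => complexifyMultilinear b L (p k) with hq
  -- This choice gives `A * ρ ≤ a`, which absorbs the factor `A ^ k`; the `+ 1` covers `A = 0`.
  set ρ : NNReal := ⟨a / (A + 1), by positivity⟩ with hρ
  have hρpos : 0 < ρ := by
    rw [← NNReal.coe_pos]
    change 0 < (a : ℝ) / (A + 1)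
    positivity
  have hqr : (ρ : ENNReal) ≤ q.radius := by
    refine q.le_radius_of_bound C₀ fun k => ?_
    refine le_trans ?_ (hC₀ k)
    calc ‖q k‖ * (ρ : ℝ) ^ k ≤ (‖p k‖ * A ^ k) * (ρ : ℝ) ^ k := by
          gcongr
          exact norm_complexifyMultilinear_le b L hB hC hB0 hC0 (p k)
      _ = ‖p k‖ * (A * ρ) ^ k := by rw [mul_pow A, mul_assoc]
      _ ≤ ‖p k‖ * (a : ℝ) ^ k := by
          gcongr
          change A * (a / (A + 1)) ≤ a
          rw [mul_div_assoc', div_le_iff₀ (by positivity)]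
          nlinarith
  have hqpos : 0 < q.radius := lt_of_lt_of_le (by exact_mod_cast hρpos) hqr
  have hR := (q.hasFPowerSeriesOnBall hqpos).comp_sub (ι x₀)
  rw [zero_add] at hR
  refine ⟨fun X => q.sum (X - ι x₀), hR.analyticAt, ?_⟩
  filter_upwards [Metric.eball_mem_nhds x₀ hp.r_pos] with x hx
  have hs := hp.hasSum_sub hx
  rw [← map_sub, ← hs.tsum_eq]
  refine tsum_congr fun k => ?_
  exact complexifyMultilinear_apply_real b L ι ℓ hb hL (p k) (x - x₀)

end Complexification

/-! ### Polarization on `ℂⁿ × ℂⁿ` and its real points -/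

/-- Coordinatewise complex conjugation on `ℂⁿ`. -/
def conjVec (n : ℕ) : Cn n ≃ₗᵢ[ℝ] Cn n :=
  LinearIsometryEquiv.piLpCongrRight 2 (fun _ : Fin n => Complex.conjLIE)

@[simp] theorem conjVec_apply {n : ℕ} (z : Cn n) (j : Fin n) : conjVec n z j = conj (z j) := rfl

@[simp] theorem conjVec_conjVec {n : ℕ} (z : Cn n) : conjVec n (conjVec n z) = z := by
  ext j; simp

@[simp] theorem conjVec_smul {n : ℕ} (c : ℂ) (z : Cn n) :
    conjVec n (c • z) = conj c • conjVec n z := by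
  ext j; simp

/-- The totally real embedding `z ↦ (z, z̄)` of `ℂⁿ` into `ℂⁿ × ℂⁿ`. -/
def realDiag (n : ℕ) : Cn n →L[ℝ] Cn n × Cn n :=
  (ContinuousLinearMap.id ℝ (Cn n)).prod (conjVec n).toContinuousLinearEquiv

@[simp] theorem realDiag_apply {n : ℕ} (z : Cn n) : realDiag n z = (z, conjVec n z) := rfl

theorem exists_polarization {n : ℕ} {f : Cn n → ℂ} {z₀ : Cn n} (hf : AnalyticAt ℝ f z₀) :
    ∃ R : Cn n × Cn n → ℂ, AnalyticAt ℂ R (z₀, conjVec n z₀) ∧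
      ∀ᶠ z in 𝓝 z₀, R (z, conjVec n z) = f z := by
  let π : Fin n → Cn n →L[ℂ] ℂ := fun j => EuclideanSpace.proj j
  let b : Fin n ⊕ Fin n → Cn n := Sum.elim (coordVec n) (fun j => Complex.I • coordVec n j)
  -- The functionals `(z + w) / 2` and `(z - w) / (2i)` restrict to real and imaginary parts on `w =
  -- z̄`.
  let L : Fin n ⊕ Fin n → Cn n × Cn n →L[ℂ] ℂ := Sum.elim
    (fun j => (2⁻¹ : ℂ) • ((π j).comp (.fst ℂ _ _) + (π j).comp (.snd ℂ _ _)))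
    (fun j => (-Complex.I / 2 : ℂ) • ((π j).comp (.fst ℂ _ _) - (π j).comp (.snd ℂ _ _)))
  let ℓ : Fin n ⊕ Fin n → Cn n → ℝ := Sum.elim (fun j z => (z j).re) (fun j z => (z j).im)
  refine exists_complexification b L (realDiag n).toLinearMap ℓ ?_ ?_ hf
  · intro x
    ext i
    simp only [b, ℓ, Fintype.sum_sum_type, Sum.elim_inl, Sum.elim_inr, coordVec]
    simp [Finset.sum_apply, Pi.single_apply, Complex.re_add_im]
  · rintro (j | j) x
    · have := Complex.add_conj (x j)
      simp only [L, ℓ, π, Sum.elim_inl]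
      simp [← mul_add, this]
    · have := Complex.sub_conj (x j)
      simp only [L, ℓ, π, Sum.elim_inr]
      simp [this]
      linear_combination (-(x j).im : ℂ) * Complex.I_mul_I

/-- A holomorphic function on a disc which vanishes at the real points vanishes identically. -/
theorem eq_zero_of_eq_zero_ofReal {h : ℂ → ℂ} {r : ℝ} (hr : 0 < r)
    (hh : DifferentiableOn ℂ h (Metric.ball 0 r))
    (h0 : ∀ t : ℝ, (t : ℂ) ∈ Metric.ball (0 : ℂ) r → h t = 0) :
    ∀ s ∈ Metric.ball (0 : ℂ) r, h s = 0 := by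
  have hfreq : ∃ᶠ s in 𝓝[≠] (0 : ℂ), h s = 0 := by
    have ht : Tendsto (fun t : ℝ => (t : ℂ)) (𝓝[≠] 0) (𝓝[≠] 0) := by
      refine tendsto_nhdsWithin_iff.2 ⟨?_, ?_⟩
      · have := (Complex.continuous_ofReal.tendsto 0)
        rw [Complex.ofReal_zero] at this
        exact this.mono_left nhdsWithin_le_nhds
      · filter_upwards [self_mem_nhdsWithin] with t ht
        simpa using ht
    refine ht.frequently (Eventually.frequently ?_)
    have hb2 : ∀ᶠ s in 𝓝[≠] (0 : ℂ), s ∈ Metric.ball (0 : ℂ) r :=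
      nhdsWithin_le_nhds (Metric.ball_mem_nhds 0 hr)
    filter_upwards [ht.eventually hb2] with t ht
    exact h0 t ht
  exact (hh.analyticOnNhd Metric.isOpen_ball).eqOn_zero_of_preconnected_of_frequently_eq_zero
    (convex_ball (0 : ℂ) r).isPreconnected (Metric.mem_ball_self hr) hfreq

/-- Every point near a real point of `ℂⁿ × ℂⁿ`, together with its conjugate, lies on a complex
line defined over the reals. -/
theorem exists_real_line {n : ℕ} {z₀ : Cn n} {ρ : ℝ} {X : Cn n × Cn n}
    (hX : X ∈ Metric.ball (z₀, conjVec n z₀) (ρ / 3)) :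
    ∃ c : ℂ → Cn n × Cn n, Differentiable ℂ c ∧
      (∀ s ∈ Metric.ball (0 : ℂ) 2, c s ∈ Metric.ball (z₀, conjVec n z₀) ρ) ∧
      (∀ t : ℝ, c t = ((c t).1, conjVec n (c t).1)) ∧ c Complex.I = X ∧
      c (-Complex.I) = (conjVec n X.2, conjVec n X.1) := by
  obtain ⟨z, w⟩ := X
  rw [mem_ball_iff_norm] at hX
  set u := z - z₀ with hu
  set v := conjVec n (w - conjVec n z₀) with hv
  have hv' : conjVec n v = w - conjVec n z₀ := by simp [hv]
  have hz : z = z₀ + u := by rw [hu]; abel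
  have hw : w = conjVec n z₀ + conjVec n v := by rw [hv']; abel
  have hun : ‖u‖ < ρ / 3 := lt_of_le_of_lt (norm_fst_le ((z, w) - (z₀, conjVec n z₀))) hX
  have hvn : ‖v‖ < ρ / 3 := by
    rw [hv, LinearIsometryEquiv.norm_map]
    exact lt_of_le_of_lt (norm_snd_le ((z, w) - (z₀, conjVec n z₀))) hX
  -- `a` and `b` solve `a + i b = u` and `a - i b = v`, so the line passes through `X` at `s = i`.
  -- The bound `‖a‖ + 2 ‖b‖ < ρ` accounts for the ratio `1/3`.
  set a : Cn n := (2⁻¹ : ℂ) • (u + v) with ha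
  set b : Cn n := (-Complex.I / 2 : ℂ) • (u - v) with hb
  have han : ‖a‖ < ρ / 3 := by
    calc ‖a‖ ≤ 2⁻¹ * (‖u‖ + ‖v‖) := by
          rw [ha, norm_smul]; simp; exact norm_add_le _ _
      _ < ρ / 3 := by linarith
  have hbn : ‖b‖ < ρ / 3 := by
    calc ‖b‖ ≤ 2⁻¹ * (‖u‖ + ‖v‖) := by
          rw [hb, norm_smul]; simp [div_eq_inv_mul]; exact norm_sub_le _ _
      _ < ρ / 3 := by linarith
  have hII := Complex.I_mul_I
  have hIb : Complex.I • b = (2⁻¹ : ℂ) • (u - v) := by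
    rw [hb, smul_smul]; congr 1; linear_combination (-1 / 2 : ℂ) * hII
  have hIb' : Complex.I • conjVec n b = -((2⁻¹ : ℂ) • (conjVec n u - conjVec n v)) := by
    rw [hb, conjVec_smul, smul_smul, ← neg_smul, map_sub]; congr 1
    simp [map_ofNat]
    linear_combination (1 / 2 : ℂ) * hII
  have ha' : conjVec n a = (2⁻¹ : ℂ) • (conjVec n u + conjVec n v) := by
    rw [ha, conjVec_smul, map_add]; simp [map_ofNat]
  refine ⟨fun s => (z₀ + a + s • b, conjVec n (z₀ + a) + s • conjVec n b), ?_, ?_, ?_, ?_, ?_⟩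
  · fun_prop
  · intro s hs
    rw [mem_ball_zero_iff] at hs
    have hsb : ‖s‖ * ‖b‖ ≤ 2 * ‖b‖ := by gcongr
    rw [mem_ball_iff_norm, Prod.norm_def]
    refine max_lt ?_ ?_
    · calc ‖z₀ + a + s • b - z₀‖ = ‖a + s • b‖ := by congr 1; abel
        _ ≤ ‖a‖ + ‖s‖ * ‖b‖ := by rw [← norm_smul]; exact norm_add_le _ _
        _ < ρ := by linarith
    · calc ‖conjVec n (z₀ + a) + s • conjVec n b - conjVec n z₀‖
          = ‖conjVec n a + s • conjVec n b‖ := by rw [map_add]; congr 1; abel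
        _ ≤ ‖conjVec n a‖ + ‖s‖ * ‖conjVec n b‖ := by
            rw [← norm_smul]; exact norm_add_le _ _
        _ < ρ := by rw [LinearIsometryEquiv.norm_map, LinearIsometryEquiv.norm_map]; linarith
  · intro t
    simp
  · refine Prod.ext ?_ ?_
    · change z₀ + a + Complex.I • b = z
      rw [hIb, ha, hu]; module
    · change conjVec n (z₀ + a) + Complex.I • conjVec n b = w
      rw [map_add, hIb', ha', hv']; module
  · refine Prod.ext ?_ ?_
    · change z₀ + a + (-Complex.I) • b = conjVec n w
      rw [neg_smul, hIb, ha, hw, map_add, conjVec_conjVec, conjVec_conjVec]; module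
    · change conjVec n (z₀ + a) + (-Complex.I) • conjVec n b = conjVec n z
      rw [neg_smul, map_add, hIb', ha', hz, map_add]; module

/-- A holomorphic function on a ball centred at a real point of `ℂⁿ × ℂⁿ` which vanishes at the
real points of the ball vanishes identically on the concentric ball of a third of the radius. -/
theorem eq_zero_of_eq_zero_realDiag {n : ℕ} {F : Cn n × Cn n → ℂ} {z₀ : Cn n} {ρ : ℝ}
    (hF : DifferentiableOn ℂ F (Metric.ball (z₀, conjVec n z₀) ρ))
    (h0 : ∀ z ∈ Metric.ball z₀ ρ, F (z, conjVec n z) = 0) :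
    ∀ X ∈ Metric.ball (z₀, conjVec n z₀) (ρ / 3), F X = 0 := by
  intro X hX
  obtain ⟨c, hc, hcb, hcr, hcI, -⟩ := exists_real_line hX
  rw [← hcI]
  refine eq_zero_of_eq_zero_ofReal (h := fun s => F (c s)) two_pos
    (hF.comp hc.differentiableOn hcb) (fun t ht => ?_) Complex.I (by simp)
  have := hcb _ ht
  rw [hcr t] at this ⊢
  rw [← ball_prod_same] at this
  exact h0 _ this.1

/-- A holomorphic function which is real at the real points commutes with the conjugation of
`ℂⁿ × ℂⁿ` with respect to its real points. -/
theorem apply_conj_of_real {n : ℕ} {F : Cn n × Cn n → ℂ} {z₀ : Cn n} {ρ : ℝ}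
    (hF : DifferentiableOn ℂ F (Metric.ball (z₀, conjVec n z₀) ρ))
    (h0 : ∀ z ∈ Metric.ball z₀ ρ, conj (F (z, conjVec n z)) = F (z, conjVec n z)) :
    ∀ X ∈ Metric.ball (z₀, conjVec n z₀) (ρ / 3),
      F (conjVec n X.2, conjVec n X.1) = conj (F X) := by
  intro X hX
  obtain ⟨c, hc, hcb, hcr, hcI, hcI'⟩ := exists_real_line hX
  rw [← hcI', ← hcI]
  have hh : DifferentiableOn ℂ (fun s => F (c s)) (Metric.ball 0 2) :=
    hF.comp hc.differentiableOn hcb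
  -- Schwarz reflection: this difference is holomorphic and vanishes for real `s`. Its vanishing at
  -- `s = -i` is the claim.
  have hh' : DifferentiableOn ℂ (fun s => F (c s) - conj (F (c (conj s)))) (Metric.ball 0 2) := by
    refine hh.sub fun s hs => DifferentiableAt.differentiableWithinAt ?_
    have hs' : conj s ∈ Metric.ball (0 : ℂ) 2 := by simpa using hs
    have h1 := (hh.differentiableAt (Metric.isOpen_ball.mem_nhds hs')).conj_conj
    rw [starRingEnd_self_apply] at h1
    exact h1
  have := eq_zero_of_eq_zero_ofReal two_pos hh' (fun t ht => ?_) (-Complex.I) (by simp)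
  · simpa [sub_eq_zero] using this
  · have := hcb _ ht
    simp only [Complex.conj_ofReal]
    rw [hcr t] at this ⊢
    rw [← ball_prod_same] at this
    rw [h0 _ this.1, sub_self]

/-! ### Segre varieties and separation of variables -/

section Segre

variable {E : Type*} [NormedAddCommGroup E] [NormedSpace ℂ E]

/-- The complexified Levi condition at a point `X` of `{R = 0}`: the mixed second derivative of `R`
vanishes on the product of the kernels of the two partial differentials. -/
def MixedHessianVanishes (R : E × E → ℂ) (X : E × E) : Prop :=
  ∀ ζ ξ : E, fderiv ℂ R X (ζ, 0) = 0 → fderiv ℂ R X (0, ξ) = 0 →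
    fderiv ℂ (fderiv ℂ R) X (ζ, 0) (0, ξ) = 0

/-- If the mixed Hessian vanishes along `{R = 0}`, then the direction of the second partial
differential of `R` is constant along the Segre varieties `{R (·, w) = 0}`. -/
theorem segre_conormal_const {R S : E × E → ℂ} {e e' z₀ z w : E} {δ : ℝ}
    (hz : z ∈ Metric.ball z₀ δ)
    (hS : ∀ z' ∈ Metric.ball z₀ δ, DifferentiableAt ℂ S (z', w))
    (hRS : ∀ z' ∈ Metric.ball z₀ δ, R ((z', w) + S (z', w) • (e, 0)) = 0)
    (hR : ∀ z' ∈ Metric.ball z₀ δ, AnalyticAt ℂ R ((z', w) + S (z', w) • (e, 0)))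
    (he' : ∀ z' ∈ Metric.ball z₀ δ, fderiv ℂ R ((z', w) + S (z', w) • (e, 0)) (0, e') ≠ 0)
    (hL : ∀ z' ∈ Metric.ball z₀ δ, MixedHessianVanishes R ((z', w) + S (z', w) • (e, 0)))
    {ξ : E} (hξ : fderiv ℂ R ((z, w) + S (z, w) • (e, 0)) (0, ξ) = 0) :
    fderiv ℂ R ((z₀, w) + S (z₀, w) • (e, 0)) (0, ξ) = 0 := by
  set p : E → E × E := fun z' => (z', w) + S (z', w) • (e, 0) with hp
  -- Only the direction of `∂_w R` is constant, not `∂_w R` itself, hence the quotient.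
  set φ : E → ℂ := fun z' => fderiv ℂ R (p z') (0, ξ) * (fderiv ℂ R (p z') (0, e'))⁻¹ with hφ
  have hδ : 0 < δ := Metric.pos_of_mem_ball hz
  have hφ' : ∀ z' ∈ Metric.ball z₀ δ, HasFDerivAt φ (0 : E →L[ℂ] ℂ) z' := by
    intro z' hz'
    have hS' : HasFDerivAt (fun y => S (y, w)) ((fderiv ℂ S (z', w)).comp (.inl ℂ E E)) z' :=
      (hS z' hz').hasFDerivAt.comp z' (hasFDerivAt_prodMk_left z' w)
    have hp' : HasFDerivAt p (ContinuousLinearMap.inl ℂ E E +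
        ((fderiv ℂ S (z', w)).comp (.inl ℂ E E)).smulRight ((e, 0) : E × E)) z' :=
      (hasFDerivAt_prodMk_left z' w).add (hS'.smul_const _)
    set η : E → E := fun ζ => ζ + fderiv ℂ S (z', w) (ζ, 0) • e with hη
    have hpη : ∀ ζ, (ContinuousLinearMap.inl ℂ E E +
        ((fderiv ℂ S (z', w)).comp (.inl ℂ E E)).smulRight ((e, 0) : E × E)) ζ = (η ζ, 0) := by
      intro ζ; simp [hη]
    have hRp : ∀ ζ, fderiv ℂ R (p z') (η ζ, 0) = 0 := by
      intro ζ
      have h1 := (hR z' hz').differentiableAt.hasFDerivAt.comp z' hp'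
      have h2 : R ∘ p =ᶠ[𝓝 z'] fun _ => 0 := by
        filter_upwards [Metric.isOpen_ball.mem_nhds hz'] with y hy using hRS y hy
      have h3 := h1.unique ((hasFDerivAt_const (0 : ℂ) z').congr_of_eventuallyEq h2)
      have h4 := congrArg (fun A => A ζ) h3
      simpa only [ContinuousLinearMap.comp_apply, hpη, zero_apply] using h4
    have hN : ∀ v : E × E, HasFDerivAt (fun y => fderiv ℂ R (p y) v)
        ((ContinuousLinearMap.apply ℂ ℂ v).comp ((fderiv ℂ (fderiv ℂ R) (p z')).comp
          (ContinuousLinearMap.inl ℂ E E +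
        ((fderiv ℂ S (z', w)).comp (.inl ℂ E E)).smulRight ((e, 0) : E × E)))) z' := by
      intro v
      exact (ContinuousLinearMap.apply ℂ ℂ v).hasFDerivAt.comp z'
        ((hR z' hz').fderiv.differentiableAt.hasFDerivAt.comp z' hp')
    have hne := he' z' hz'
    have hinv := (hasDerivAt_inv hne).comp_hasFDerivAt z' (hN (0, e'))
    have hmul := (hN (0, ξ)).mul hinv
    refine hmul.congr_fderiv ?_
    ext ζ
    set A := fderiv ℂ R (p z') (0, e') with hA
    set B := fderiv ℂ R (p z') (0, ξ) with hB
    -- The numerator of the derivative of `φ` is the mixed Hessian paired with `A • ξ - B • e'`, a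
    -- vector killed by `∂_w R`.
    have hlev := hL z' hz' (η ζ) (A • ξ - B • e') (hRp ζ) (by
      have : ((0, A • ξ - B • e') : E × E) = A • (0, ξ) - B • (0, e') := by simp
      rw [this, map_sub, map_smul, map_smul]
      simp only [smul_eq_mul]
      exact sub_eq_zero.2 (mul_comm _ _))
    have : ((0, A • ξ - B • e') : E × E) = A • (0, ξ) - B • (0, e') := by simp
    rw [this, map_sub, map_smul, map_smul] at hlev
    simp only [smul_eq_mul] at hlev
    simp only [add_apply, smul_apply,
      ContinuousLinearMap.comp_apply (ContinuousLinearMap.apply ℂ ℂ _),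
      ContinuousLinearMap.comp_apply (fderiv ℂ (fderiv ℂ R) (p z')), hpη,
      ContinuousLinearMap.apply_apply, smul_eq_mul, zero_apply]
    change B * (-(A ^ 2)⁻¹ * _) + A⁻¹ * _ = 0
    field_simp
    linear_combination hlev
  have hconst : φ z = φ z₀ := by
    refine Metric.isOpen_ball.is_const_of_fderiv_eq_zero (𝕜 := ℂ)
      (convex_ball z₀ δ).isPreconnected (fun y hy => (hφ' y hy).differentiableAt.differentiableWithinAt)
      (fun y hy => (hφ' y hy).fderiv) hz (Metric.mem_ball_self hδ)
  have h1 : φ z = 0 := by simp only [hφ, hp]; rw [hξ, zero_mul]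
  rw [h1] at hconst
  have := (mul_eq_zero.1 hconst.symm).resolve_right (inv_ne_zero (he' z₀ (Metric.mem_ball_self hδ)))
  exact this

/-- If the mixed Hessian of `R` vanishes along `{R = 0}`, then this hypersurface is locally
contained in the locus where a function of `w` and a function of `z` agree. -/
theorem exists_separation [CompleteSpace E] {R : E × E → ℂ} {z₀ w₀ e e' : E}
    (hR : AnalyticAt ℂ R (z₀, w₀)) (h0 : R (z₀, w₀) = 0)
    (he : fderiv ℂ R (z₀, w₀) (e, 0) ≠ 0) (he' : fderiv ℂ R (z₀, w₀) (0, e') ≠ 0)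
    (hL : ∀ᶠ X in 𝓝 (z₀, w₀), R X = 0 → MixedHessianVanishes R X) :
    ∃ b σ : E → ℂ, AnalyticAt ℂ b w₀ ∧ AnalyticAt ℂ σ z₀ ∧ σ z₀ = 0 ∧ fderiv ℂ σ z₀ e ≠ 0 ∧
      (∀ᶠ q : E × ℂ in 𝓝 (w₀, 0), R (z₀ + q.2 • e, q.1) = 0 ↔ b q.1 = q.2) ∧
      (∀ᶠ z in 𝓝 z₀, R (z, w₀ + σ z • e') = 0) ∧
      ∀ᶠ X in 𝓝 (z₀, w₀), R X = 0 → b X.2 = b (w₀ + σ X.1 • e') := by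
  obtain ⟨S, hSa, hS0, hS⟩ := exists_implicit_along (k := ω) (by simp) hR.contDiffAt h0 he
  obtain ⟨S', hSa', hS0', hS'⟩ := exists_implicit_along (k := ω) (by simp) hR.contDiffAt h0 he'
  replace hSa := hSa.analyticAt
  replace hSa' := hSa'.analyticAt
  have hdR : ContinuousAt (fderiv ℂ R) (z₀, w₀) := hR.fderiv.continuousAt
  have hgood : ∀ᶠ X in 𝓝 (z₀, w₀), AnalyticAt ℂ R X ∧ fderiv ℂ R X (e, 0) ≠ 0 ∧
      fderiv ℂ R X (0, e') ≠ 0 ∧ (R X = 0 → MixedHessianVanishes R X) ∧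
      AnalyticAt ℂ S X ∧ AnalyticAt ℂ S' X ∧ R (X + S X • (e, 0)) = 0 ∧
      R (X + S' X • (0, e')) = 0 ∧ (R X = 0 ↔ S X = 0) ∧ (R X = 0 ↔ S' X = 0) := by
    filter_upwards [hR.eventually_analyticAt,
      (hdR.clm_apply continuousAt_const).eventually_ne he,
      (hdR.clm_apply continuousAt_const).eventually_ne he', hL,
      hSa.eventually_analyticAt, hSa'.eventually_analyticAt,
      eventually_apply_implicit_along hSa.continuousAt hS0 hS,
      eventually_apply_implicit_along hSa'.continuousAt hS0' hS',
      eventually_eq_zero_iff_implicit_along hS, eventually_eq_zero_iff_implicit_along hS']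
      with X h1 h2 h3 h4 h5 h6 h7 h8 h9 h10
    exact ⟨h1, h2, h3, h4, h5, h6, h7, h8, h9, h10⟩
  obtain ⟨δ₀, hδ₀, hball₀⟩ := Metric.eventually_nhds_iff_ball.1 hgood
  have hshift : ∀ {U : E × E → ℂ} {v : E × E}, AnalyticAt ℂ U (z₀, w₀) → U (z₀, w₀) = 0 →
      ∀ {r : ℝ}, 0 < r → ∀ᶠ X in 𝓝 (z₀, w₀), X + U X • v ∈ Metric.ball (z₀, w₀) r := by
    intro U v hU hU0 r hr
    have : ContinuousAt (fun X => X + U X • v) (z₀, w₀) :=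
      continuousAt_id.add (hU.continuousAt.smul continuousAt_const)
    refine this.eventually_mem ?_
    simpa [hU0] using Metric.ball_mem_nhds _ hr
  -- The radii are nested: sliding by `S` maps the `δ₁`-ball into the `δ₀`-ball, and sliding by `S'`
  -- maps the `δ`-ball into the `δ₁`-ball.
  obtain ⟨δ₁, hδ₁, hball₁⟩ := Metric.eventually_nhds_iff_ball.1
    ((hshift (v := (e, 0)) hSa hS0 hδ₀).and (Metric.ball_mem_nhds (z₀, w₀) hδ₀))
  obtain ⟨δ, hδ, hball⟩ := Metric.eventually_nhds_iff_ball.1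
    ((hshift (v := (0, e')) hSa' hS0' hδ₁).and (Metric.ball_mem_nhds (z₀, w₀) hδ₁))
  set b : E → ℂ := fun w => S (z₀, w) with hb
  set σ : E → ℂ := fun z => S' (z, w₀) with hσ
  have hmk : ∀ {r : ℝ} {z w : E}, z ∈ Metric.ball z₀ r → w ∈ Metric.ball w₀ r →
      (z, w) ∈ Metric.ball (z₀, w₀) r := by
    intro r z w hz hw
    rw [← ball_prod_same]; exact ⟨hz, hw⟩
  have hbd : ∀ w ∈ Metric.ball w₀ δ₁, HasFDerivAt b ((fderiv ℂ S (z₀, w)).comp (.inr ℂ E E)) w := by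
    intro w hw
    have hX := hball₀ _ (hball₁ _ (hmk (Metric.mem_ball_self hδ₁) hw)).2
    exact hX.2.2.2.2.1.differentiableAt.hasFDerivAt.comp w (hasFDerivAt_prodMk_right z₀ w)
  -- Transport the kernel of `∂_w R` along the Segre variety to the point over `z₀`; there,
  -- differentiating `R (z₀ + b w • e, w) = 0` along `ξ` gives `db(ξ) = 0`.
  have hker : ∀ X ∈ Metric.ball (z₀, w₀) δ₁, R X = 0 → ∀ ξ, fderiv ℂ R X (0, ξ) = 0 →
      fderiv ℂ b X.2 ξ = 0 := by
    rintro ⟨z, w⟩ hX hRX ξ hξ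
    have hX' := hX
    rw [← ball_prod_same] at hX'
    obtain ⟨hz, hw⟩ := hX'
    have hg : ∀ z' ∈ Metric.ball z₀ δ₁, ∀ w' ∈ Metric.ball w₀ δ₁, _ := fun z' hz' w' hw' =>
      hball₀ _ (hball₁ _ (hmk hz' hw')).2
    have hg1 : ∀ z' ∈ Metric.ball z₀ δ₁, ∀ w' ∈ Metric.ball w₀ δ₁, _ := fun z' hz' w' hw' =>
      hball₀ _ (hball₁ _ (hmk hz' hw')).1
    have hz₀ : z₀ ∈ Metric.ball z₀ δ₁ := Metric.mem_ball_self hδ₁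
    have hRS : ∀ z' ∈ Metric.ball z₀ δ₁, ∀ w' ∈ Metric.ball w₀ δ₁,
        R ((z', w') + S (z', w') • (e, 0)) = 0 :=
      fun z' hz' w' hw' => (hg z' hz' w' hw').2.2.2.2.2.2.1
    have hSX : S (z, w) = 0 := (hg z hz w hw).2.2.2.2.2.2.2.2.1.1 hRX
    have h1 : fderiv ℂ R ((z₀, w) + S (z₀, w) • (e, 0)) (0, ξ) = 0 := by
      refine segre_conormal_const (e' := e') hz
        (fun z' hz' => (hg z' hz' w hw).2.2.2.2.1.differentiableAt)
        (fun z' hz' => hRS z' hz' w hw) (fun z' hz' => (hg1 z' hz' w hw).1)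
        (fun z' hz' => (hg1 z' hz' w hw).2.2.1)
        (fun z' hz' => (hg1 z' hz' w hw).2.2.2.1 (hRS z' hz' w hw)) ?_
      rw [hSX, zero_smul, add_zero]
      exact hξ
    have hp : HasFDerivAt (fun w' => (z₀, w') + S (z₀, w') • ((e, 0) : E × E))
        (.inr ℂ E E + ((fderiv ℂ S (z₀, w)).comp (.inr ℂ E E)).smulRight ((e, 0) : E × E)) w :=
      (hasFDerivAt_prodMk_right z₀ w).add ((hbd w hw).smul_const _)
    have h2 := (hg1 z₀ hz₀ w hw).1.differentiableAt.hasFDerivAt.comp w hp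
    have h3 : (R ∘ fun w' => (z₀, w') + S (z₀, w') • ((e, 0) : E × E)) =ᶠ[𝓝 w] fun _ => 0 := by
      filter_upwards [Metric.isOpen_ball.mem_nhds hw] with y hy using hRS z₀ hz₀ y hy
    have h4 := congrArg (fun A => A ξ)
      (h2.unique ((hasFDerivAt_const (0 : ℂ) w).congr_of_eventuallyEq h3))
    have h5 : (.inr ℂ E E + ((fderiv ℂ S (z₀, w)).comp (.inr ℂ E E)).smulRight
        ((e, 0) : E × E)) ξ = (0, ξ) + fderiv ℂ S (z₀, w) (0, ξ) • ((e, 0) : E × E) := by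
      simp
    simp only [ContinuousLinearMap.comp_apply] at h4
    erw [h5] at h4
    rw [map_add, h1, map_smul, zero_add, smul_eq_mul] at h4
    rw [(hbd w hw).fderiv]
    exact (mul_eq_zero.1 h4).resolve_right (hg1 z₀ hz₀ w hw).2.1
  refine ⟨b, σ, ?_, ?_, hS0', ?_, ?_, ?_, ?_⟩
  · exact AnalyticAt.fun_comp (f := fun w => (z₀, w)) hSa (analyticAt_const.prod analyticAt_id)
  · exact AnalyticAt.fun_comp (f := fun z => (z, w₀)) hSa' (analyticAt_id.prod analyticAt_const)
  -- If `dσ(e) = 0`, differentiating `R (z, w₀ + σ z • e') = 0` along `e` contradicts `he`.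
  · intro hσe
    have hσd : HasFDerivAt σ ((fderiv ℂ S' (z₀, w₀)).comp (.inl ℂ E E)) z₀ :=
      hSa'.differentiableAt.hasFDerivAt.comp z₀ (hasFDerivAt_prodMk_left z₀ w₀)
    have hp : HasFDerivAt (fun z => (z, w₀) + S' (z, w₀) • ((0, e') : E × E))
        (.inl ℂ E E + ((fderiv ℂ S' (z₀, w₀)).comp (.inl ℂ E E)).smulRight ((0, e') : E × E)) z₀ :=
      (hasFDerivAt_prodMk_left z₀ w₀).add (hσd.smul_const _)
    have h1 : HasFDerivAt R (fderiv ℂ R (z₀, w₀))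
        ((z₀, w₀) + S' (z₀, w₀) • ((0, e') : E × E)) := by
      rw [hS0', zero_smul, add_zero]; exact hR.differentiableAt.hasFDerivAt
    have h2 := h1.comp z₀ hp
    have h3 : (R ∘ fun z => (z, w₀) + S' (z, w₀) • ((0, e') : E × E)) =ᶠ[𝓝 z₀] fun _ => 0 := by
      filter_upwards [Metric.ball_mem_nhds z₀ hδ₀] with y hy using
        (hball₀ _ (hmk hy (Metric.mem_ball_self hδ₀))).2.2.2.2.2.2.2.1
    have h4 := congrArg (fun A => A e)
      (h2.unique ((hasFDerivAt_const (0 : ℂ) z₀).congr_of_eventuallyEq h3))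
    have h5 : (.inl ℂ E E + ((fderiv ℂ S' (z₀, w₀)).comp (.inl ℂ E E)).smulRight
        ((0, e') : E × E)) e = (e, 0) + fderiv ℂ S' (z₀, w₀) (e, 0) • ((0, e') : E × E) := by
      simp
    have h6 : fderiv ℂ S' (z₀, w₀) (e, 0) = 0 := by
      rw [hσd.fderiv] at hσe
      exact hσe
    simp only [ContinuousLinearMap.comp_apply] at h4
    erw [h5] at h4
    rw [h6, zero_smul, add_zero] at h4
    exact he h4
  · have ht : Tendsto (fun q : E × ℂ => (((z₀, q.1), q.2) : (E × E) × ℂ)) (𝓝 (w₀, 0))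
        (𝓝 ((z₀, w₀), 0)) := by
      have : Continuous (fun q : E × ℂ => (((z₀, q.1), q.2) : (E × E) × ℂ)) := by fun_prop
      exact this.tendsto (w₀, 0)
    filter_upwards [ht.eventually hS] with q hq
    simpa using hq
  · filter_upwards [Metric.ball_mem_nhds z₀ hδ₀] with y hy
    simpa using (hball₀ _ (hmk hy (Metric.mem_ball_self hδ₀))).2.2.2.2.2.2.2.1
  · filter_upwards [Metric.ball_mem_nhds (z₀, w₀) hδ]
    rintro ⟨z, w⟩ hX hRX
    have hX' := hX
    rw [← ball_prod_same] at hX'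
    obtain ⟨hz, hw⟩ := hX'
    set p : E → E × E := fun w' => (z, w') + S' (z, w') • ((0, e') : E × E) with hp
    have hg : ∀ w' ∈ Metric.ball w₀ δ, _ := fun w' hw' =>
      hball₀ _ (hball₁ _ (hball _ (hmk hz hw')).2).2
    have hp1 : ∀ w' ∈ Metric.ball w₀ δ, p w' ∈ Metric.ball (z₀, w₀) δ₁ := fun w' hw' =>
      (hball _ (hmk hz hw')).1
    have hRp : ∀ w' ∈ Metric.ball w₀ δ, R (p w') = 0 := fun w' hw' =>
      (hg w' hw').2.2.2.2.2.2.2.1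
    -- `p` slides points along `e'` onto `{R (z, ·) = 0}`, so `hker` makes `b` constant along it. It
    -- fixes `w`, where `R` vanishes, and sends `w₀` to `w₀ + σ z • e'`.
    have hψ : ∀ w' ∈ Metric.ball w₀ δ, HasFDerivAt (fun y => b (p y).2) (0 : E →L[ℂ] ℂ) w' := by
      intro w' hw'
      have hS1 : HasFDerivAt (fun y => S' (z, y)) ((fderiv ℂ S' (z, w')).comp (.inr ℂ E E)) w' :=
        (hg w' hw').2.2.2.2.2.1.differentiableAt.hasFDerivAt.comp w' (hasFDerivAt_prodMk_right z w')
      have hpd : HasFDerivAt p (.inr ℂ E E +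
          ((fderiv ℂ S' (z, w')).comp (.inr ℂ E E)).smulRight ((0, e') : E × E)) w' :=
        (hasFDerivAt_prodMk_right z w').add (hS1.smul_const _)
      have h5 : ∀ ξ, (.inr ℂ E E + ((fderiv ℂ S' (z, w')).comp (.inr ℂ E E)).smulRight
          ((0, e') : E × E)) ξ = (0, ξ + fderiv ℂ S' (z, w') (0, ξ) • e') := by
        intro ξ; simp
      have h2 := (hball₀ _ (hball₁ _ (hp1 w' hw')).2).1.differentiableAt.hasFDerivAt.comp w' hpd
      have h3 : R ∘ p =ᶠ[𝓝 w'] fun _ => 0 := by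
        filter_upwards [Metric.isOpen_ball.mem_nhds hw'] with y hy using hRp y hy
      have hb2 : (p w').2 ∈ Metric.ball w₀ δ₁ := by
        have := hp1 w' hw'
        rw [← ball_prod_same] at this
        exact this.2
      have hbp : HasFDerivAt b (fderiv ℂ b (p w').2) (p w').2 :=
        (hbd _ hb2).differentiableAt.hasFDerivAt
      have h6 : HasFDerivAt (fun y => (p y).2) _ w' := hpd.snd
      refine (hbp.comp w' h6).congr_fderiv ?_
      ext ξ
      have h4 := congrArg (fun A => A ξ)
        (h2.unique ((hasFDerivAt_const (0 : ℂ) w').congr_of_eventuallyEq h3))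
      simp only [ContinuousLinearMap.comp_apply] at h4 ⊢
      erw [h5] at h4 ⊢
      exact hker _ (hp1 w' hw') (hRp w' hw') _ h4
    have hconst := Metric.isOpen_ball.is_const_of_fderiv_eq_zero (𝕜 := ℂ)
      (convex_ball w₀ δ).isPreconnected
      (fun y hy => (hψ y hy).differentiableAt.differentiableWithinAt)
      (fun y hy => (hψ y hy).fderiv) hw (Metric.mem_ball_self hδ)
    have hS'X : S' (z, w) = 0 := (hg w hw).2.2.2.2.2.2.2.2.2.1 hRX
    simpa [hp, hS'X] using hconst

end Segre

/-! ### The Levi form in polarized variables -/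

section LeviForm

variable {n : ℕ}

theorem hasFDerivAt_comp_realDiag {A : Cn n × Cn n → ℂ} {z : Cn n}
    (hA : DifferentiableAt ℂ A (z, conjVec n z)) :
    HasFDerivAt (fun ζ => A (ζ, conjVec n ζ))
      (((fderiv ℂ A (z, conjVec n z)).restrictScalars ℝ).comp (realDiag n)) z :=
  HasFDerivAt.comp (g := A) (f := realDiag n) z (hA.hasFDerivAt.restrictScalars ℝ)
    (realDiag n).hasFDerivAt

theorem conjVec_coordVec (j : Fin n) : conjVec n (coordVec n j) = coordVec n j := by
  ext i
  simp [coordVec, apply_ite conj]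

theorem map_prod_eq_add (D : Cn n × Cn n →L[ℂ] ℂ) (a c : Cn n) :
    D (a, c) = D (a, 0) + D (0, c) := by
  rw [← map_add]; simp

theorem map_smul_fst (D : Cn n × Cn n →L[ℂ] ℂ) (s : ℂ) (a : Cn n) :
    D (s • a, 0) = s * D (a, 0) := by
  rw [← smul_eq_mul, ← map_smul]; simp

theorem map_smul_snd (D : Cn n × Cn n →L[ℂ] ℂ) (s : ℂ) (a : Cn n) :
    D (0, s • a) = s * D (0, a) := by
  rw [← smul_eq_mul, ← map_smul]; simp

/-- Multiplying the direction by `i` multiplies the first-slot derivative by `i` and the second-slot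
one by `-i`, so the Wirtinger combination isolates one slot. -/
theorem dz_comp_realDiag {A : Cn n × Cn n → ℂ} {z : Cn n}
    (hA : DifferentiableAt ℂ A (z, conjVec n z)) (j : Fin n) :
    dz j (fun ζ => A (ζ, conjVec n ζ)) z = fderiv ℂ A (z, conjVec n z) (coordVec n j, 0) := by
  rw [dz, (hasFDerivAt_comp_realDiag hA).fderiv]
  simp only [ContinuousLinearMap.comp_apply, realDiag_apply, conjVec_smul, conjVec_coordVec,
    ContinuousLinearMap.coe_restrictScalars']
  rw [map_prod_eq_add, map_prod_eq_add _ (Complex.I • _), map_smul_fst, map_smul_snd,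
    Complex.conj_I]
  linear_combination (-(1 / 2 : ℂ) * (fderiv ℂ A (z, conjVec n z) (coordVec n j, 0)) +
    (1 / 2 : ℂ) * (fderiv ℂ A (z, conjVec n z) (0, coordVec n j))) * Complex.I_mul_I

theorem dzbar_comp_realDiag {A : Cn n × Cn n → ℂ} {z : Cn n}
    (hA : DifferentiableAt ℂ A (z, conjVec n z)) (j : Fin n) :
    dzbar j (fun ζ => A (ζ, conjVec n ζ)) z = fderiv ℂ A (z, conjVec n z) (0, coordVec n j) := by
  rw [dzbar, (hasFDerivAt_comp_realDiag hA).fderiv]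
  simp only [ContinuousLinearMap.comp_apply, realDiag_apply, conjVec_smul, conjVec_coordVec,
    ContinuousLinearMap.coe_restrictScalars']
  rw [map_prod_eq_add, map_prod_eq_add _ (Complex.I • _), map_smul_fst, map_smul_snd,
    Complex.conj_I]
  linear_combination ((1 / 2 : ℂ) * (fderiv ℂ A (z, conjVec n z) (coordVec n j, 0)) -
    (1 / 2 : ℂ) * (fderiv ℂ A (z, conjVec n z) (0, coordVec n j))) * Complex.I_mul_I

theorem sum_smul_coordVec (w : Cn n) : ∑ j, w j • coordVec n j = w := by
  ext i
  simp [coordVec, Finset.sum_apply, Pi.single_apply]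

/-- The Levi form of a real analytic function is the mixed second derivative of its
polarization. -/
theorem leviForm_eq {r : Cn n → ℝ} {R : Cn n × Cn n → ℂ} {z : Cn n}
    (hR : AnalyticAt ℂ R (z, conjVec n z))
    (hr : ∀ᶠ ζ in 𝓝 z, R (ζ, conjVec n ζ) = r ζ) (w : Cn n) :
    leviForm r z w =
      fderiv ℂ (fderiv ℂ R) (z, conjVec n z) (w, 0) (0, conjVec n w) := by
  have hιc : ContinuousAt (fun ζ : Cn n => (ζ, conjVec n ζ)) z := (realDiag n).continuous.continuousAt
  have h1 : ∀ k, dzbar k (fun ζ => (r ζ : ℂ)) =ᶠ[𝓝 z]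
      fun ζ => fderiv ℂ R (ζ, conjVec n ζ) (0, coordVec n k) := by
    intro k
    filter_upwards [hιc.eventually hR.eventually_analyticAt, hr.eventually_nhds] with ζ hζ hζr
    rw [← dzbar_comp_realDiag hζ.differentiableAt]
    have : (fun ζ => (r ζ : ℂ)) =ᶠ[𝓝 ζ] fun ζ => R (ζ, conjVec n ζ) := by
      filter_upwards [hζr] with y hy using hy.symm
    simp only [dzbar, this.fderiv_eq]
  have h2 : ∀ j k, dz j (dzbar k (fun ζ => (r ζ : ℂ))) z =
      fderiv ℂ (fderiv ℂ R) (z, conjVec n z) (coordVec n j, 0) (0, coordVec n k) := by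
    intro j k
    have hd : HasFDerivAt (fun X => fderiv ℂ R X (0, coordVec n k))
        ((ContinuousLinearMap.apply ℂ ℂ (0, coordVec n k)).comp
          (fderiv ℂ (fderiv ℂ R) (z, conjVec n z))) (z, conjVec n z) :=
      (ContinuousLinearMap.apply ℂ ℂ ((0, coordVec n k) : Cn n × Cn n)).hasFDerivAt.comp _
        hR.fderiv.differentiableAt.hasFDerivAt
    have := dz_comp_realDiag hd.differentiableAt j
    rw [hd.fderiv] at this
    simp only [dz, (h1 k).fderiv_eq] at this ⊢
    rw [this]
    rfl
  have hw : ((w, 0) : Cn n × Cn n) = ∑ j, w j • ((coordVec n j, 0) : Cn n × Cn n) := by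
    conv_lhs => rw [← sum_smul_coordVec w]
    refine Prod.ext ?_ ?_ <;> simp [Prod.fst_sum, Prod.snd_sum]
  have hw' : ((0, conjVec n w) : Cn n × Cn n) =
      ∑ k, conj (w k) • ((0, coordVec n k) : Cn n × Cn n) := by
    conv_lhs => rw [← sum_smul_coordVec (conjVec n w)]
    refine Prod.ext ?_ ?_ <;> simp [Prod.fst_sum, Prod.snd_sum]
  rw [hw, map_sum, sum_apply]
  simp only [leviForm, h2]
  refine Finset.sum_congr rfl fun j _ => ?_
  rw [hw', map_sum]
  refine Finset.sum_congr rfl fun k _ => ?_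
  simp only [map_smul, smul_apply, smul_eq_mul]
  ring

theorem fderiv_polarization {r : Cn n → ℝ} {R : Cn n × Cn n → ℂ} {z : Cn n}
    (hR : AnalyticAt ℂ R (z, conjVec n z)) (hrd : DifferentiableAt ℝ r z)
    (hr : ∀ᶠ ζ in 𝓝 z, R (ζ, conjVec n ζ) = r ζ) (w : Cn n) :
    (fderiv ℝ r z w : ℂ) = fderiv ℂ R (z, conjVec n z) (w, 0) +
      fderiv ℂ R (z, conjVec n z) (0, conjVec n w) := by
  have h1 : HasFDerivAt (fun ζ => (r ζ : ℂ)) (Complex.ofRealCLM.comp (fderiv ℝ r z)) z :=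
    Complex.ofRealCLM.hasFDerivAt.comp z hrd.hasFDerivAt
  have h2 := (hasFDerivAt_comp_realDiag hR.differentiableAt).congr_of_eventuallyEq
    (show (fun ζ => (r ζ : ℂ)) =ᶠ[𝓝 z] fun ζ => R (ζ, conjVec n ζ) by
      filter_upwards [hr] with y hy using hy.symm)
  have h3 := congrArg (fun A => A w) (h1.unique h2)
  rw [← map_prod_eq_add]
  exact h3

theorem fderiv_polarization_fst {r : Cn n → ℝ} {R : Cn n × Cn n → ℂ} {z : Cn n}
    (hR : AnalyticAt ℂ R (z, conjVec n z)) (hrd : DifferentiableAt ℝ r z)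
    (hr : ∀ᶠ ζ in 𝓝 z, R (ζ, conjVec n ζ) = r ζ) (w : Cn n) :
    fderiv ℂ R (z, conjVec n z) (w, 0) =
      (fderiv ℝ r z w - Complex.I * fderiv ℝ r z (Complex.I • w)) / 2 := by
  rw [fderiv_polarization hR hrd hr, fderiv_polarization hR hrd hr, conjVec_smul, map_smul_fst,
    map_smul_snd, Complex.conj_I]
  linear_combination ((1 / 2 : ℂ) * fderiv ℂ R (z, conjVec n z) (w, 0) -
    (1 / 2 : ℂ) * fderiv ℂ R (z, conjVec n z) (0, conjVec n w)) * Complex.I_mul_I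

theorem fderiv_polarization_snd {r : Cn n → ℝ} {R : Cn n × Cn n → ℂ} {z : Cn n}
    (hR : AnalyticAt ℂ R (z, conjVec n z)) (hrd : DifferentiableAt ℝ r z)
    (hr : ∀ᶠ ζ in 𝓝 z, R (ζ, conjVec n ζ) = r ζ) (w : Cn n) :
    fderiv ℂ R (z, conjVec n z) (0, conjVec n w) =
      (fderiv ℝ r z w + Complex.I * fderiv ℝ r z (Complex.I • w)) / 2 := by
  have h1 := fderiv_polarization_fst hR hrd hr w
  have h2 := fderiv_polarization hR hrd hr w
  linear_combination -h2 - h1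

theorem re_im_eq_zero_of_add_I_mul {a b : ℝ} (h : ((a : ℂ) + Complex.I * b) / 2 = 0) :
    a = 0 ∧ b = 0 := by
  have h1 : (a : ℂ) + Complex.I * b = 0 := by linear_combination 2 * h
  constructor
  · simpa using congrArg Complex.re h1
  · simpa using congrArg Complex.im h1

/-- As `r` is real, `dr(w)` and `dr(iw)` are, up to sign and a factor 2, the real and imaginary
parts of `∂_z R(w)`. -/
theorem mem_complexTangent_of_fst {r : Cn n → ℝ} {R : Cn n × Cn n → ℂ} {z : Cn n}
    (hR : AnalyticAt ℂ R (z, conjVec n z)) (hrd : DifferentiableAt ℝ r z)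
    (hr : ∀ᶠ ζ in 𝓝 z, R (ζ, conjVec n ζ) = r ζ) {w : Cn n}
    (hw : fderiv ℂ R (z, conjVec n z) (w, 0) = 0) : w ∈ complexTangent r z := by
  rw [fderiv_polarization_fst hR hrd hr] at hw
  have := re_im_eq_zero_of_add_I_mul (a := fderiv ℝ r z w)
    (b := -fderiv ℝ r z (Complex.I • w)) (by rw [← hw]; push_cast; ring)
  exact ⟨this.1, neg_eq_zero.1 this.2⟩

theorem mem_complexTangent_of_snd {r : Cn n → ℝ} {R : Cn n × Cn n → ℂ} {z : Cn n}
    (hR : AnalyticAt ℂ R (z, conjVec n z)) (hrd : DifferentiableAt ℝ r z)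
    (hr : ∀ᶠ ζ in 𝓝 z, R (ζ, conjVec n ζ) = r ζ) {w : Cn n}
    (hw : fderiv ℂ R (z, conjVec n z) (0, conjVec n w) = 0) : w ∈ complexTangent r z := by
  rw [fderiv_polarization_snd hR hrd hr] at hw
  exact re_im_eq_zero_of_add_I_mul hw

/-- Vanishing of the Levi form on the complex tangent space, in polarized form. -/
theorem mixedHessianVanishes_of_leviForm {r : Cn n → ℝ} {R : Cn n × Cn n → ℂ} {z : Cn n}
    (hR : AnalyticAt ℂ R (z, conjVec n z)) (hrd : DifferentiableAt ℝ r z)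
    (hr : ∀ᶠ ζ in 𝓝 z, R (ζ, conjVec n ζ) = r ζ)
    (hL : ∀ w ∈ complexTangent r z, leviForm r z w = 0) :
    MixedHessianVanishes R (z, conjVec n z) := by
  intro ζ ξ hζ hξ
  set D := fderiv ℂ (fderiv ℂ R) (z, conjVec n z)
  have hζ' := mem_complexTangent_of_fst hR hrd hr hζ
  have hξ' : conjVec n ξ ∈ complexTangent r z :=
    mem_complexTangent_of_snd hR hrd hr (by rwa [conjVec_conjVec])
  set c := conjVec n ξ with hc
  have hξc : ξ = conjVec n c := by simp [hc]
  have hadd : ∀ {a d : Cn n}, a ∈ complexTangent r z → d ∈ complexTangent r z →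
      a + d ∈ complexTangent r z := by
    rintro a d ⟨h1, h2⟩ ⟨h3, h4⟩
    exact ⟨by rw [map_add, h1, h3, add_zero], by rw [smul_add, map_add, h2, h4, add_zero]⟩
  have hI : Complex.I • c ∈ complexTangent r z := by
    refine ⟨hξ'.2, ?_⟩
    rw [smul_smul, Complex.I_mul_I, neg_smul, one_smul, map_neg, hξ'.1, neg_zero]
  have hD : ∀ a ∈ complexTangent r z, D (a, 0) (0, conjVec n a) = 0 := fun a ha => by
    rw [← leviForm_eq hR hr]; exact hL a ha
  have hexp : ∀ a d : Cn n, D (a + d, 0) (0, conjVec n (a + d)) =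
      D (a, 0) (0, conjVec n a) + D (a, 0) (0, conjVec n d) + D (d, 0) (0, conjVec n a) +
        D (d, 0) (0, conjVec n d) := by
    intro a d
    have h1 : ((a + d, 0) : Cn n × Cn n) = (a, 0) + (d, 0) := by simp
    have h2 : ((0, conjVec n (a + d)) : Cn n × Cn n) = (0, conjVec n a) + (0, conjVec n d) := by
      simp
    rw [h1, h2, map_add, map_add, add_apply, add_apply]
    ring
  -- The form is known only on the diagonal; the expansions at `ζ + c` and `ζ + i c` recover its
  -- off-diagonal values.
  have h1 := hexp ζ c
  have h2 := hexp ζ (Complex.I • c)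
  rw [hD _ (hadd hζ' hξ'), hD _ hζ', hD _ hξ'] at h1
  rw [hD _ (hadd hζ' hI), hD _ hζ', hD _ hI, conjVec_smul, map_smul_snd] at h2
  have h3 : D (Complex.I • c, 0) (0, conjVec n ζ) = Complex.I * D (c, 0) (0, conjVec n ζ) := by
    have : ((Complex.I • c, 0) : Cn n × Cn n) = Complex.I • (c, 0) := by simp
    rw [this, map_smul, smul_apply, smul_eq_mul]
  rw [h3, Complex.conj_I] at h2
  rw [hξc]
  linear_combination (-1 / 2 : ℂ) * h1 - (1 / 2) * Complex.I * h2 +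
    (1 / 2) * (D (ζ, 0) (0, conjVec n c) - D (c, 0) (0, conjVec n ζ)) * Complex.I_mul_I

end LeviForm

/-! ### Local flattening of a Levi-flat hypersurface -/

section Flattening

variable {n : ℕ}

/-- The Levi condition at the real points of `{R = 0}` propagates to a neighbourhood in the
complexified hypersurface. -/
theorem eventually_mixedHessianVanishes {r : Cn n → ℝ} {R : Cn n × Cn n → ℂ} {z₀ e : Cn n}
    (hR : AnalyticAt ℂ R (z₀, conjVec n z₀)) (hra : AnalyticAt ℝ r z₀) (hr0 : r z₀ = 0)
    (hr : ∀ᶠ z in 𝓝 z₀, R (z, conjVec n z) = r z) (he : fderiv ℝ r z₀ e ≠ 0)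
    (he₁ : fderiv ℂ R (z₀, conjVec n z₀) (e, 0) ≠ 0)
    (he₂ : fderiv ℂ R (z₀, conjVec n z₀) (0, conjVec n e) ≠ 0)
    (hL : ∀ᶠ z in 𝓝 z₀, r z = 0 → MixedHessianVanishes R (z, conjVec n z)) :
    ∀ᶠ X in 𝓝 (z₀, conjVec n z₀), R X = 0 → MixedHessianVanishes R X := by
  set X₀ : Cn n × Cn n := (z₀, conjVec n z₀) with hX₀
  set v : Cn n × Cn n := (e, conjVec n e) with hv
  have hR0 : R X₀ = 0 := by rw [hr.self_of_nhds, hr0, Complex.ofReal_zero]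
  have hRv : fderiv ℂ R X₀ v ≠ 0 := by
    rw [hv, map_prod_eq_add, ← fderiv_polarization hR hra.differentiableAt hr]
    exact_mod_cast he
  obtain ⟨T, hTa, hT0, hT⟩ := exists_implicit_along (k := ω) (by simp) hR.contDiffAt hR0 hRv
  obtain ⟨t, hta, ht0, ht⟩ := exists_implicit_along (k := ω) (by simp) hra.contDiffAt hr0 he
  replace hTa := hTa.analyticAt
  have htc : ContinuousAt t z₀ := hta.continuousAt
  have hshift : Tendsto (fun z => z + t z • e) (𝓝 z₀) (𝓝 z₀) := by
    have : ContinuousAt (fun z => z + t z • e) z₀ :=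
      continuousAt_id.add (htc.smul continuousAt_const)
    simpa [ContinuousAt, ht0] using this
  have hrt := eventually_apply_implicit_along htc ht0 ht
  have hTt : ∀ᶠ z in 𝓝 z₀, T (z, conjVec n z) = t z := by
    have : Tendsto (fun z => (((z, conjVec n z), (t z : ℂ)) : (Cn n × Cn n) × ℂ)) (𝓝 z₀)
        (𝓝 (X₀, 0)) := by
      have : ContinuousAt (fun z => (((z, conjVec n z), (t z : ℂ)) : (Cn n × Cn n) × ℂ)) z₀ :=
        (realDiag n).continuous.continuousAt.prodMk
          (Complex.continuous_ofReal.continuousAt.comp htc)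
      simpa [ContinuousAt, ht0] using this
    filter_upwards [this.eventually hT, hrt, hshift.eventually hr] with z h1 h2 h3
    refine h1.1 ?_
    rw [h2] at h3
    simpa [hv] using h3
  -- `Y` retracts holomorphically onto `{R = 0}` along the real vector `v`. It preserves real
  -- points, where `T` equals the real number `t`.
  set Y : Cn n × Cn n → Cn n × Cn n := fun X => X + T X • v with hY
  have hYc : Tendsto Y (𝓝 X₀) (𝓝 X₀) := by
    have : ContinuousAt Y X₀ := continuousAt_id.add (hTa.continuousAt.smul continuousAt_const)
    simpa [ContinuousAt, hY, hT0] using this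
  have hreal : ∀ᶠ z in 𝓝 z₀, MixedHessianVanishes R (Y (z, conjVec n z)) := by
    filter_upwards [hTt, hrt, hshift.eventually hL] with z h1 h2 h3
    have := h3 h2
    simpa [hY, hv, h1] using this
  obtain ⟨ρ₁, hρ₁, h₁⟩ := Metric.eventually_nhds_iff_ball.1 hreal
  obtain ⟨ρ₂, hρ₂, h₂⟩ := Metric.eventually_nhds_iff_ball.1
    (hTa.eventually_analyticAt.and (hYc.eventually hR.eventually_analyticAt))
  set ρ := min ρ₁ ρ₂
  have hρ : 0 < ρ := lt_min hρ₁ hρ₂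
  have hdR : ContinuousAt (fderiv ℂ R) X₀ := hR.fderiv.continuousAt
  filter_upwards [Metric.ball_mem_nhds X₀ (div_pos hρ three_pos),
    (hdR.clm_apply continuousAt_const).eventually_ne he₁,
    (hdR.clm_apply continuousAt_const).eventually_ne he₂,
    eventually_eq_zero_iff_implicit_along hT] with X hX hXe hXe' hXT hRX ζ ξ hζ hξ
  -- `u` and `u'` are holomorphic fields in the kernels of the partial differentials. At `X` they
  -- are nonzero multiples of `(ζ, 0)` and `(0, ξ)`.
  set u : Cn n × Cn n → Cn n × Cn n := fun Z =>
    fderiv ℂ R Z (e, 0) • (ζ, 0) - fderiv ℂ R Z (ζ, 0) • (e, 0) with hu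
  set u' : Cn n × Cn n → Cn n × Cn n := fun Z =>
    fderiv ℂ R Z (0, conjVec n e) • (0, ξ) - fderiv ℂ R Z (0, ξ) • (0, conjVec n e) with hu'
  set Λ : Cn n × Cn n → ℂ := fun Z => fderiv ℂ (fderiv ℂ R) Z (u Z) (u' Z) with hΛ
  have hΛ0 : ∀ Z, MixedHessianVanishes R Z → Λ Z = 0 := by
    intro Z hZ
    have h1 : u Z = (fderiv ℂ R Z (e, 0) • ζ - fderiv ℂ R Z (ζ, 0) • e, 0) := by simp [hu]
    have h2 : u' Z = (0, fderiv ℂ R Z (0, conjVec n e) • ξ - fderiv ℂ R Z (0, ξ) • conjVec n e) := by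
      simp [hu']
    have h3 : fderiv ℂ R Z (u Z) = 0 := by
      simp only [hu, map_sub, map_smul, smul_eq_mul]; ring
    have h4 : fderiv ℂ R Z (u' Z) = 0 := by
      simp only [hu', map_sub, map_smul, smul_eq_mul]; ring
    simp only [hΛ]
    rw [h1] at h3 ⊢
    rw [h2] at h4 ⊢
    exact hZ _ _ h3 h4
  have hF : DifferentiableOn ℂ (fun Z => Λ (Y Z)) (Metric.ball X₀ ρ) := by
    intro Z hZ
    obtain ⟨h3, h4⟩ := h₂ Z (Metric.ball_subset_ball (min_le_right _ _) hZ)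
    refine DifferentiableAt.differentiableWithinAt ?_
    have hYd : DifferentiableAt ℂ Y Z :=
      differentiableAt_id.add (h3.differentiableAt.smul_const v)
    have hΛd : DifferentiableAt ℂ Λ (Y Z) := by
      have h5 : ∀ a, DifferentiableAt ℂ (fun Z => fderiv ℂ R Z a) (Y Z) := fun a =>
        h4.fderiv.differentiableAt.clm_apply (differentiableAt_const a)
      have h6 : DifferentiableAt ℂ u (Y Z) :=
        ((h5 _).smul_const _).sub ((h5 _).smul_const _)
      have h7 : DifferentiableAt ℂ u' (Y Z) :=
        ((h5 _).smul_const _).sub ((h5 _).smul_const _)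
      exact (h4.fderiv.fderiv.differentiableAt.clm_apply h6).clm_apply h7
    exact hΛd.comp Z hYd
  have h0 := eq_zero_of_eq_zero_realDiag hF
    (fun z hz => hΛ0 _ (h₁ z (Metric.ball_subset_ball (min_le_left _ _) hz))) X hX
  have hYX : Y X = X := by simp [hY, hXT.1 hRX]
  simp only [hYX, hΛ, hu, hu', hζ, hξ, zero_smul, sub_zero, map_smul, smul_apply, smul_eq_mul,
    mul_eq_zero] at h0
  exact (h0.resolve_left hXe').resolve_left hXe

/-- Two nested regular level sets of codimension one coincide locally. -/
theorem eventually_eq_zero_of_imp {E : Type*} [NormedAddCommGroup E] [NormedSpace ℝ E]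
    [CompleteSpace E] {r s : E → ℝ} {z₀ : E} (hr : ContDiffAt ℝ 1 r z₀) (hs : ContDiffAt ℝ 1 s z₀)
    (hr0 : r z₀ = 0) (hdr : fderiv ℝ r z₀ ≠ 0) (hds : fderiv ℝ s z₀ ≠ 0)
    (h : ∀ᶠ z in 𝓝 z₀, r z = 0 → s z = 0) : ∀ᶠ z in 𝓝 z₀, s z = 0 → r z = 0 := by
  obtain ⟨e, he⟩ : ∃ e, fderiv ℝ r z₀ e ≠ 0 := by
    by_contra! hc
    exact hdr (ContinuousLinearMap.ext hc)
  obtain ⟨t, hta, ht0, ht⟩ := exists_implicit_along one_ne_zero hr hr0 he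
  have htd := (hta.differentiableAt one_ne_zero).hasFDerivAt
  have hpd : HasFDerivAt (fun z => z + t z • e)
      (ContinuousLinearMap.id ℝ E + (fderiv ℝ t z₀).smulRight e) z₀ :=
    (hasFDerivAt_id z₀).add (htd.smul_const e)
  have hshift : Tendsto (fun z => z + t z • e) (𝓝 z₀) (𝓝 z₀) := by
    simpa [ContinuousAt, ht0] using hpd.continuousAt
  have hst : ∀ᶠ z in 𝓝 z₀, s (z + t z • e) = 0 := by
    filter_upwards [hshift.eventually h, eventually_apply_implicit_along hta.continuousAt ht0 ht]
      with z h1 h2 using h1 h2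
  have hs0 : s z₀ = 0 := h.self_of_nhds hr0
  -- `s` vanishes after sliding onto `{r = 0}` along `e`, so `ds(u) + dt(u) ds(e) = 0` for all `u`;
  -- `ds(e) = 0` would force `ds = 0`. Hence both zero sets are cut out by slides along `e`, and
  -- uniqueness of these slides gives `t' = t`.
  have hse : fderiv ℝ s z₀ e ≠ 0 := by
    intro hse
    refine hds (ContinuousLinearMap.ext fun u => ?_)
    have h1 : HasFDerivAt s (fderiv ℝ s z₀) (z₀ + t z₀ • e) := by
      rw [ht0, zero_smul, add_zero]
      exact (hs.differentiableAt one_ne_zero).hasFDerivAt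
    have h2 := (h1.comp z₀ hpd).unique
      ((hasFDerivAt_const (0 : ℝ) z₀).congr_of_eventuallyEq
        (show (s ∘ fun z => z + t z • e) =ᶠ[𝓝 z₀] fun _ => 0 from hst))
    have h3 := congrArg (fun A => A u) h2
    simpa [hse] using h3
  obtain ⟨t', -, ht0', ht'⟩ := exists_implicit_along one_ne_zero hs hs0 hse
  have hpair : Tendsto (fun z => (z, t z)) (𝓝 z₀) (𝓝 (z₀, 0)) := by
    have := continuousAt_id.prodMk hta.continuousAt
    simpa [ContinuousAt, ht0] using this
  filter_upwards [hst, hpair.eventually ht', eventually_eq_zero_iff_implicit_along ht',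
    eventually_eq_zero_iff_implicit_along ht] with z h1 h2 h3 h4 hsz
  exact h4.2 ((h2.1 h1).symm.trans (h3.1 hsz))

/-- A Levi-flat real analytic hypersurface of `ℂⁿ` is locally the zero locus of the imaginary part
of a holomorphic submersion. -/
theorem exists_holomorphic_flattening {r : Cn n → ℝ} {z₀ : Cn n}
    (hra : AnalyticAt ℝ r z₀) (hr0 : r z₀ = 0) (hdr : fderiv ℝ r z₀ ≠ 0)
    (hL : ∀ᶠ z in 𝓝 z₀, r z = 0 → ∀ w ∈ complexTangent r z, leviForm r z w = 0) :
    ∃ G : Cn n → ℂ, AnalyticAt ℂ G z₀ ∧ fderiv ℂ G z₀ ≠ 0 ∧ G z₀ = 0 ∧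
      ∀ᶠ z in 𝓝 z₀, r z = 0 ↔ (G z).im = 0 := by
  obtain ⟨R, hR, hr⟩ := exists_polarization (f := fun z => (r z : ℂ))
    (Complex.ofRealCLM.analyticAt _ |>.comp hra)
  obtain ⟨e, he⟩ : ∃ e, fderiv ℝ r z₀ e ≠ 0 := by
    by_contra! hc
    exact hdr (ContinuousLinearMap.ext hc)
  have he₁ : fderiv ℂ R (z₀, conjVec n z₀) (e, 0) ≠ 0 := by
    intro h
    exact he (mem_complexTangent_of_fst hR hra.differentiableAt hr h).1
  have he₂ : fderiv ℂ R (z₀, conjVec n z₀) (0, conjVec n e) ≠ 0 := by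
    intro h
    exact he (mem_complexTangent_of_snd hR hra.differentiableAt hr h).1
  have hιc : Tendsto (fun z : Cn n => (z, conjVec n z)) (𝓝 z₀) (𝓝 (z₀, conjVec n z₀)) :=
    (realDiag n).continuous.tendsto z₀
  have hLR : ∀ᶠ z in 𝓝 z₀, r z = 0 → MixedHessianVanishes R (z, conjVec n z) := by
    filter_upwards [hL, hιc.eventually hR.eventually_analyticAt, hr.eventually_nhds,
      hra.eventually_analyticAt] with z h1 h2 h3 h4 h5
    exact mixedHessianVanishes_of_leviForm h2 h4.differentiableAt h3 (h1 h5)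
  have hR0 : R (z₀, conjVec n z₀) = 0 := by rw [hr.self_of_nhds, hr0, Complex.ofReal_zero]
  obtain ⟨b, σ, hb, hσ, hσ0, hσe, hbR, hσR, hsep⟩ := exists_separation hR hR0 he₁ he₂
    (eventually_mixedHessianVanishes hR hra hr0 hr he he₁ he₂ hLR)
  obtain ⟨ρ₁, hρ₁, h₁⟩ := Metric.eventually_nhds_iff_ball.1 hR.eventually_analyticAt
  obtain ⟨ρ₂, hρ₂, h₂⟩ := Metric.eventually_nhds_iff_ball.1 hr
  have hρ : 0 < min ρ₁ ρ₂ := lt_min hρ₁ hρ₂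
  have hconj := apply_conj_of_real (F := R) (z₀ := z₀) (ρ := min ρ₁ ρ₂)
    (fun X hX => (h₁ X (Metric.ball_subset_ball (min_le_left _ _) hX)).differentiableAt.differentiableWithinAt)
    (fun z hz => by
      rw [h₂ z (Metric.ball_subset_ball (min_le_right _ _) hz), Complex.conj_ofReal])
  have hw : ContinuousAt (fun z => conjVec n z₀ + σ z • conjVec n e) z₀ :=
    continuousAt_const.add (hσ.continuousAt.smul continuousAt_const)
  have hpair : Tendsto (fun z => (z, conjVec n z₀ + σ z • conjVec n e)) (𝓝 z₀)
      (𝓝 (z₀, conjVec n z₀)) := by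
    have := continuousAt_id.prodMk hw
    simpa [ContinuousAt, hσ0] using this
  have hpair' : Tendsto (fun z => (conjVec n z, conj (σ z))) (𝓝 z₀) (𝓝 (conjVec n z₀, 0)) := by
    have := (conjVec n).continuous.continuousAt.prodMk
      (Complex.continuous_conj.continuousAt.comp hσ.continuousAt)
    simpa [ContinuousAt, hσ0] using this
  set g : Cn n → ℂ := fun z => b (conjVec n z₀ + σ z • conjVec n e) with hg
  have hga : AnalyticAt ℂ g z₀ := by
    refine AnalyticAt.fun_comp (f := fun z => conjVec n z₀ + σ z • conjVec n e) ?_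
      (analyticAt_const.add (hσ.smul analyticAt_const))
    simpa [hσ0] using hb
  -- Conjugating `R (z, w₀ + σ z • ē) = 0`, with `w₀ = z̄₀`, gives `R (z₀ + conj (σ z) • e, z̄) =
  -- 0`, which identifies `b z̄` with `conj (σ z)`. Separation at `(z, z̄)` gives `b z̄ = g z`.
  have hgσ : ∀ᶠ z in 𝓝 z₀, r z = 0 → g z = conj (σ z) := by
    filter_upwards [hιc.eventually hsep, hσR, hpair'.eventually hbR, hr,
      hpair.eventually (Metric.ball_mem_nhds _ (div_pos hρ three_pos))] with z h3 h4 h5 h6 h7 h8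
    have h9 := hconj _ h7
    simp only [map_add, conjVec_conjVec, conjVec_smul] at h9
    rw [h4, map_zero] at h9
    rw [← h5.1 h9]
    exact (h3 (by rw [h6, h8, Complex.ofReal_zero])).symm
  have hg0 : g z₀ = 0 := by rw [hgσ.self_of_nhds hr0, hσ0, map_zero]
  have key : ∀ G : Cn n → ℂ, AnalyticAt ℂ G z₀ → fderiv ℂ G z₀ ≠ 0 → G z₀ = 0 →
      (∀ᶠ z in 𝓝 z₀, r z = 0 → (G z).im = 0) →
      ∃ G : Cn n → ℂ, AnalyticAt ℂ G z₀ ∧ fderiv ℂ G z₀ ≠ 0 ∧ G z₀ = 0 ∧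
        ∀ᶠ z in 𝓝 z₀, r z = 0 ↔ (G z).im = 0 := by
    intro G hG hdG hG0 hGr
    refine ⟨G, hG, hdG, hG0, ?_⟩
    have hGd : HasFDerivAt (fun z => (G z).im)
        (Complex.imCLM.comp ((fderiv ℂ G z₀).restrictScalars ℝ)) z₀ :=
      Complex.imCLM.hasFDerivAt.comp z₀ (hG.differentiableAt.hasFDerivAt.restrictScalars ℝ)
    have hGc : ContDiffAt ℝ 1 (fun z => (G z).im) z₀ :=
      Complex.imCLM.contDiff.contDiffAt.comp z₀ (hG.contDiffAt.restrict_scalars ℝ)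
    have hds : fderiv ℝ (fun z => (G z).im) z₀ ≠ 0 := by
      rw [hGd.fderiv]
      intro h
      refine hdG (ContinuousLinearMap.ext fun u => ?_)
      have h1 : (fderiv ℂ G z₀ u).im = 0 := congrArg (fun A => A u) h
      have h2 : (fderiv ℂ G z₀ (Complex.I • u)).im = 0 := congrArg (fun A => A (Complex.I • u)) h
      rw [map_smul] at h2
      refine Complex.ext ?_ h1
      simpa using h2
    filter_upwards [hGr, eventually_eq_zero_of_imp hra.contDiffAt hGc hr0 hdr hds hGr]
      with z h3 h4 using ⟨h3, h4⟩
  -- On `M` the two candidates are `2 Re σ` and `-2 Im σ`. Their differentials cannot both vanish,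
  -- since `dσ(e) ≠ 0`.
  by_cases hcase : fderiv ℂ (fun z => σ z + g z) z₀ = 0
  · refine key (fun z => Complex.I * (σ z - g z)) (analyticAt_const.mul (hσ.sub hga)) ?_
      (by simp [hσ0, hg0]) ?_
    · intro h
      have h1 := congrArg (fun A => A e) hcase
      have h2 := congrArg (fun A => A e) h
      have h3 : HasFDerivAt (fun z => σ z + g z) _ z₀ :=
        hσ.differentiableAt.hasFDerivAt.add hga.differentiableAt.hasFDerivAt
      have h4 : HasFDerivAt (fun z => Complex.I * (σ z - g z)) _ z₀ :=
        (hσ.differentiableAt.hasFDerivAt.sub hga.differentiableAt.hasFDerivAt).const_mul Complex.I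
      simp only [h3.fderiv, add_apply, zero_apply] at h1
      simp only [h4.fderiv, smul_apply, sub_apply, zero_apply, smul_eq_mul, mul_eq_zero,
        Complex.I_ne_zero, false_or] at h2
      exact hσe (by linear_combination (1 / 2 : ℂ) * h1 + (1 / 2) * h2)
    · filter_upwards [hgσ] with z h1 h2
      rw [h1 h2]
      simp
  · refine key (fun z => σ z + g z) (hσ.add hga) hcase (by simp [hσ0, hg0]) ?_
    filter_upwards [hgσ] with z h1 h2
    rw [h1 h2]
    simp

end Flattening

/-! ### Regularity and rigidity of holomorphic functions -/

section Holomorphic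

variable {E : Type*} [NormedAddCommGroup E] [NormedSpace ℂ E]

/-- A complex differentiable function on an open subset of a finite-dimensional space is
continuously differentiable. -/
theorem contDiffOn_one_of_differentiableOn [FiniteDimensional ℂ E] {f : E → ℂ} {W : Set E}
    (hW : IsOpen W) (hf : DifferentiableOn ℂ f W) : ContDiffOn ℂ 1 f W := by
  rw [show (1 : ℕ∞ω) = 0 + 1 from rfl, contDiffOn_succ_iff_fderiv_of_isOpen hW]
  -- In finite dimension, continuity of `z ↦ df_z(u)` for each fixed `u` suffices. It follows from
  -- Cauchy's estimate on discs of radius `ρ` in direction `u`, applied to a difference of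
  -- translates that is uniformly small.
  refine ⟨hf, by simp, contDiffOn_zero.2 (continuousOn_clm_apply.2 fun u z₀ hz₀ => ?_)⟩
  refine ContinuousAt.continuousWithinAt ?_
  obtain ⟨R₀, hR₀, hball⟩ := Metric.isOpen_iff.1 hW z₀ hz₀
  set R : ℝ := R₀ / 3 with hR
  have hRpos : 0 < R := by positivity
  have hsub : Metric.closedBall z₀ (2 * R) ⊆ W :=
    (Metric.closedBall_subset_ball (by linarith)).trans hball
  have : ProperSpace E := FiniteDimensional.proper ℂ E
  have huc := (isCompact_closedBall z₀ (2 * R)).uniformContinuousOn_of_continuous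
    (hf.continuousOn.mono hsub)
  set ρ : ℝ := R / (‖u‖ + 1) with hρ
  have hu1 : 0 < ‖u‖ + 1 := by positivity
  have hρpos : 0 < ρ := by positivity
  have hρu : ρ * ‖u‖ ≤ R := by
    rw [hρ, div_mul_eq_mul_div, div_le_iff₀ hu1]
    nlinarith
  have hmem : ∀ z ∈ Metric.ball z₀ R, ∀ s : ℂ, ‖s‖ ≤ ρ → z + s • u ∈ Metric.closedBall z₀ (2 * R) := by
    intro z hz s hs
    rw [mem_closedBall_iff_norm]
    rw [mem_ball_iff_norm] at hz
    have h1 : ‖s‖ * ‖u‖ ≤ ρ * ‖u‖ := by gcongr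
    calc ‖z + s • u - z₀‖ = ‖(z - z₀) + s • u‖ := by congr 1; abel
      _ ≤ ‖z - z₀‖ + ‖s‖ * ‖u‖ := by rw [← norm_smul]; exact norm_add_le _ _
      _ ≤ 2 * R := by linarith
  have hderiv : ∀ z ∈ Metric.ball z₀ R, ∀ s : ℂ, ‖s‖ ≤ ρ →
      HasDerivAt (fun s : ℂ => f (z + s • u)) (fderiv ℂ f (z + s • u) u) s := by
    intro z hz s hs
    have h1 := (hf.differentiableAt (hW.mem_nhds (hsub (hmem z hz s hs)))).hasFDerivAt
    have h2 : HasDerivAt (fun s : ℂ => z + s • u) u s := by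
      simpa using ((hasDerivAt_id s).smul_const u).const_add z
    exact h1.comp_hasDerivAt s h2
  rw [Metric.continuousAt_iff]
  intro ε hε
  obtain ⟨δ, hδ, hδf⟩ := Metric.uniformContinuousOn_iff.1 huc (ε * ρ / 2) (by positivity)
  refine ⟨min δ R, lt_min hδ hRpos, fun z hz => ?_⟩
  have hzR : z ∈ Metric.ball z₀ R := lt_of_lt_of_le hz (min_le_right _ _)
  have hzδ : dist z z₀ < δ := lt_of_lt_of_le hz (min_le_left _ _)
  have hz₀R : z₀ ∈ Metric.ball z₀ R := Metric.mem_ball_self hRpos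
  have hd : ∀ s : ℂ, ‖s‖ ≤ ρ → HasDerivAt (fun s : ℂ => f (z + s • u) - f (z₀ + s • u))
      (fderiv ℂ f (z + s • u) u - fderiv ℂ f (z₀ + s • u) u) s := fun s hs =>
    (hderiv z hzR s hs).sub (hderiv z₀ hz₀R s hs)
  have hcl : DiffContOnCl ℂ (fun s : ℂ => f (z + s • u) - f (z₀ + s • u)) (Metric.ball 0 ρ) := by
    refine DifferentiableOn.diffContOnCl fun s hs => ?_
    rw [closure_ball _ hρpos.ne', mem_closedBall_zero_iff] at hs
    exact (hd s hs).differentiableAt.differentiableWithinAt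
  have hle := Complex.norm_deriv_le_of_forall_mem_sphere_norm_le hρpos hcl (C := ε * ρ / 2)
    (fun s hs => by
      rw [mem_sphere_zero_iff_norm] at hs
      rw [← dist_eq_norm]
      refine (hδf _ (hmem z hzR s hs.le) _ (hmem z₀ hz₀R s hs.le) ?_).le
      simpa using hzδ)
  rw [(hd 0 (by simpa using hρpos.le)).deriv] at hle
  simp only [zero_smul, add_zero] at hle
  rw [dist_eq_norm]
  refine hle.trans_lt ?_
  rw [div_lt_iff₀ hρpos]
  nlinarith [mul_pos hε hρpos]

/-- A real-valued holomorphic function on a connected open set is constant. -/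
theorem eq_of_im_eq_zero {f : E → ℂ} {U : Set E} (hU : IsOpen U) (hUc : IsPreconnected U)
    (hf : DifferentiableOn ℂ f U) (him : ∀ z ∈ U, (f z).im = 0) {a c : E} (ha : a ∈ U)
    (hc : c ∈ U) : f a = f c := by
  refine hU.is_const_of_fderiv_eq_zero (𝕜 := ℂ) hUc hf (fun z hz => ?_) ha hc
  have hd := (hf.differentiableAt (hU.mem_nhds hz)).hasFDerivAt
  have h1 : HasFDerivAt (fun z => (f z).im)
      (Complex.imCLM.comp ((fderiv ℂ f z).restrictScalars ℝ)) z :=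
    Complex.imCLM.hasFDerivAt.comp z (hd.restrictScalars ℝ)
  have h2 : (fun z => (f z).im) =ᶠ[𝓝 z] fun _ => 0 := by
    filter_upwards [hU.mem_nhds hz] with y hy using him y hy
  have h := h1.unique ((hasFDerivAt_const (0 : ℝ) z).congr_of_eventuallyEq h2)
  ext u
  have h3 : (fderiv ℂ f z u).im = 0 := congrArg (fun A => A u) h
  have h4 : (fderiv ℂ f z (Complex.I • u)).im = 0 := congrArg (fun A => A (Complex.I • u)) h
  rw [map_smul] at h4
  refine Complex.ext ?_ h3
  simpa using h4

end Holomorphic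

/-! ### Straightening a holomorphic submersion -/

/-- Coordinates `(x, y) ∈ ℂⁿ⁻¹ × ℂ` adapted to a codimension one foliation. -/
abbrev FoliatedSpace (n : ℕ) : Type := (Fin (n - 1) → ℂ) × ℂ

/-- A nonzero linear functional is the last component of a linear coordinate system. -/
theorem exists_equiv_snd_eq {n : ℕ} (hn : 1 ≤ n) {D : Cn n →L[ℂ] ℂ} (hD : D ≠ 0) :
    ∃ A : Cn n ≃L[ℂ] FoliatedSpace n, ∀ z, (A z).2 = D z := by
  obtain ⟨v, hv⟩ : ∃ v, D v ≠ 0 := by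
    by_contra! hc
    exact hD (ContinuousLinearMap.ext hc)
  have hsurj : Function.Surjective D.toLinearMap := fun c =>
    ⟨(c / D v) • v, by simp [hv]⟩
  have hrank : Module.finrank ℂ (LinearMap.ker D.toLinearMap) = n - 1 := by
    have := D.toLinearMap.finrank_range_add_finrank_ker
    rw [LinearMap.range_eq_top.2 hsurj, finrank_top] at this
    simp at this
    omega
  have e : LinearMap.ker D.toLinearMap ≃ₗ[ℂ] (Fin (n - 1) → ℂ) :=
    LinearEquiv.ofFinrankEq _ _ (by rw [hrank]; simp)
  let v' : Cn n := (D v)⁻¹ • v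
  have hv' : D v' = 1 := by simp [v', hv]
  let π : Cn n →ₗ[ℂ] LinearMap.ker D.toLinearMap :=
    LinearMap.codRestrict _ (LinearMap.id - D.toLinearMap.smulRight v') (fun z => by
      simp [hv'])
  let A : Cn n →ₗ[ℂ] FoliatedSpace n := (e.toLinearMap.comp π).prod D.toLinearMap
  have hinj : Function.Injective A := by
    rw [← LinearMap.ker_eq_bot, LinearMap.ker_eq_bot']
    intro z hz
    have h1 : D z = 0 := congrArg Prod.snd hz
    have h2 : e (π z) = 0 := congrArg Prod.fst hz
    have h3 : π z = 0 := by simpa using h2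
    have h4 : z - D z • v' = 0 := congrArg Subtype.val h3
    simpa [h1] using h4
  have hfin : Module.finrank ℂ (Cn n) = Module.finrank ℂ (FoliatedSpace n) := by
    simp; omega
  let A' := LinearEquiv.ofInjectiveOfFinrankEq A hinj hfin
  exact ⟨A'.toContinuousLinearEquiv, fun z => rfl⟩

/-- A holomorphic submersion is locally the last component of a holomorphic coordinate system. -/
theorem exists_straightening {n : ℕ} (hn : 1 ≤ n) {G : Cn n → ℂ} {z₀ : Cn n}
    (hG : AnalyticAt ℂ G z₀) (hdG : fderiv ℂ G z₀ ≠ 0) (hG0 : G z₀ = 0) {O : Set (Cn n)}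
    (hO : O ∈ 𝓝 z₀) :
    ∃ Φ : OpenPartialHomeomorph (Cn n) (FoliatedSpace n), z₀ ∈ Φ.source ∧ Φ.source ⊆ O ∧
      Φ z₀ = 0 ∧ (∀ z, (Φ z).2 = G z) ∧ ContDiffOn ℂ ω Φ Φ.source ∧
      ContDiffOn ℂ ω Φ.symm Φ.target := by
  obtain ⟨A, hA⟩ := exists_equiv_snd_eq hn hdG
  -- The last component of `A` is `dG`, so the derivative of `P` at `z₀` is `A`, and the inverse
  -- function theorem applies.
  set P : Cn n → FoliatedSpace n := fun z => ((A (z - z₀)).1, G z) with hP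
  have hPa : AnalyticAt ℂ P z₀ := by
    refine AnalyticAt.prod ?_ hG
    have : AnalyticAt ℂ (fun z => ((ContinuousLinearMap.fst ℂ _ _).comp
      (A : Cn n →L[ℂ] FoliatedSpace n)) (z - z₀)) z₀ := by
      refine AnalyticAt.fun_comp (ContinuousLinearMap.analyticAt _ _) ?_
      exact analyticAt_id.sub analyticAt_const
    exact this
  have hPd : HasFDerivAt P (A : Cn n →L[ℂ] FoliatedSpace n) z₀ := by
    have h1 : HasFDerivAt (fun z => A (z - z₀)) (A : Cn n →L[ℂ] FoliatedSpace n) z₀ := by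
      exact ((A : Cn n →L[ℂ] FoliatedSpace n).hasFDerivAt.comp z₀
        ((hasFDerivAt_id z₀).sub_const z₀)).congr_fderiv (ContinuousLinearMap.comp_id _)
    refine (h1.fst.prodMk hG.differentiableAt.hasFDerivAt).congr_fderiv ?_
    ext z
    · rfl
    · exact (hA z).symm
  set Ψ := hPa.contDiffAt.toOpenPartialHomeomorph P hPd (n := ω) (by simp) with hΨ
  have hΨP : ∀ z, Ψ z = P z := fun z => rfl
  have hzΨ : z₀ ∈ Ψ.source := hPa.contDiffAt.mem_toOpenPartialHomeomorph_source hPd (by simp)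
  have hPz : P z₀ = 0 := by simp [hP, hG0]
  have hsymm : ContDiffAt ℂ ω Ψ.symm (Ψ z₀) :=
    Ψ.contDiffAt_symm (Ψ.map_source hzΨ) (f₀' := A) (by rwa [Ψ.left_inv hzΨ])
      (by rw [Ψ.left_inv hzΨ]; exact hPa.contDiffAt)
  have hev : ∀ᶠ z in 𝓝 z₀, z ∈ O ∧ AnalyticAt ℂ P z ∧ AnalyticAt ℂ Ψ.symm (Ψ z) := by
    filter_upwards [hO, hPa.eventually_analyticAt,
      (Ψ.continuousAt hzΨ).eventually hsymm.analyticAt.eventually_analyticAt] with z h1 h2 h3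
    exact ⟨h1, h2, h3⟩
  obtain ⟨U, hU, hUo, hzU⟩ := eventually_nhds_iff.1 hev
  refine ⟨Ψ.restrOpen U hUo, ⟨hzΨ, hzU⟩, fun z hz => (hU z hz.2).1, hPz, fun z => rfl, ?_, ?_⟩
  · exact fun z hz => (hU z hz.2).2.1.contDiffAt.contDiffWithinAt
  · intro y hy
    have h1 := (Ψ.restrOpen U hUo).map_target hy
    have h2 := (hU _ h1.2).2.2
    have h3 : Ψ ((Ψ.restrOpen U hUo).symm y) = y := (Ψ.restrOpen U hUo).right_inv hy
    rw [h3] at h2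
    exact h2.contDiffAt.contDiffWithinAt

/-! ### Flat charts and their transition maps -/

section Charts

variable {n : ℕ} {X : Type*} [TopologicalSpace X] [ChartedSpace (Cn n) X]
  {E E' : Type*} [NormedAddCommGroup E] [NormedSpace ℂ E] [NormedAddCommGroup E']
  [NormedSpace ℂ E']

variable (n) in
/-- A biholomorphic map from an open subset of `X` onto an open subset of `E`. -/
structure IsHolomorphicChart (φ : OpenPartialHomeomorph X E) : Prop where
  holomorphic : ContMDiffOn 𝓘(ℂ, Cn n) 𝓘(ℂ, E) ω φ φ.source
  holomorphic_symm : ContMDiffOn 𝓘(ℂ, E) 𝓘(ℂ, Cn n) ω φ.symm φ.target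

theorem isHolomorphicChart_chartAt [IsManifold 𝓘(ℂ, Cn n) ω X] (p : X) :
    IsHolomorphicChart n (chartAt (Cn n) p) :=
  ⟨contMDiffOn_chart, contMDiffOn_chart_symm⟩

theorem IsHolomorphicChart.trans {φ : OpenPartialHomeomorph X E} (hφ : IsHolomorphicChart n φ)
    {Ψ : OpenPartialHomeomorph E E'} (hΨ : ContDiffOn ℂ ω Ψ Ψ.source)
    (hΨ' : ContDiffOn ℂ ω Ψ.symm Ψ.target) : IsHolomorphicChart n (φ.trans Ψ) := by
  constructor
  · change ContMDiffOn 𝓘(ℂ, Cn n) 𝓘(ℂ, E') ω (Ψ ∘ φ) (φ.trans Ψ).source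
    refine hΨ.contMDiffOn.comp (hφ.holomorphic.mono ?_) ?_
    · exact fun x hx => hx.1
    · exact fun x hx => hx.2
  · change ContMDiffOn 𝓘(ℂ, E') 𝓘(ℂ, Cn n) ω (φ.symm ∘ Ψ.symm) (φ.trans Ψ).target
    refine hφ.holomorphic_symm.comp (hΨ'.contMDiffOn.mono ?_) ?_
    · exact fun x hx => hx.1
    · exact fun x hx => hx.2

theorem IsHolomorphicChart.contDiffOn_comp_symm {φ : OpenPartialHomeomorph X E}
    (hφ : IsHolomorphicChart n φ) {ψ : OpenPartialHomeomorph X E'}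
    (hψ : IsHolomorphicChart n ψ) :
    ContDiffOn ℂ ω (fun z => ψ (φ.symm z)) (φ.target ∩ φ.symm ⁻¹' ψ.source) := by
  rw [← contMDiffOn_iff_contDiffOn]
  exact hψ.holomorphic.comp (hφ.holomorphic_symm.mono inter_subset_left) fun z hz => hz.2

theorem IsHolomorphicChart.analyticAt_comp_symm [CompleteSpace E'] {φ : OpenPartialHomeomorph X E}
    (hφ : IsHolomorphicChart n φ) {ψ : OpenPartialHomeomorph X E'}
    (hψ : IsHolomorphicChart n ψ) {x : X} (hx : x ∈ φ.source) (hx' : x ∈ ψ.source) :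
    AnalyticAt ℂ (fun z => ψ (φ.symm z)) (φ x) := by
  refine ((hφ.contDiffOn_comp_symm hψ).contDiffAt ((φ.isOpen_inter_preimage_symm ψ.open_source).mem_nhds ?_)).analyticAt
  exact ⟨φ.map_source hx, by simpa [φ.left_inv hx] using hx'⟩

/-- A holomorphic chart in which `M` is the zero locus of the imaginary part of the last
coordinate. -/
structure IsFlatChart (M : Set X) (Φ : OpenPartialHomeomorph X (FoliatedSpace n)) : Prop
    extends IsHolomorphicChart n Φ where
  mem_iff : ∀ x ∈ Φ.source, x ∈ M ↔ (Φ x).2.im = 0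

/-- The flattening function becomes the last coordinate after straightening; the domain is shrunk to
where `{r = 0}` and `{Im G = 0}` agree. -/
theorem exists_isFlatChart [IsManifold 𝓘(ℂ, Cn n) ω X] (hn : 1 ≤ n) {M : Set X}
    (hM : IsLeviFlat n M) {p : X} (hp : p ∈ M) :
    ∃ Φ : OpenPartialHomeomorph X (FoliatedSpace n),
      IsFlatChart M Φ ∧ p ∈ Φ.source ∧ Φ p = 0 := by
  obtain ⟨W, r, hr, hpW, hL⟩ := hM p hp
  set e := chartAt (Cn n) p with he
  have hpe : p ∈ e.source := mem_chart_source _ p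
  have hr0 : r (e p) = 0 := (hr.mem_iff _ hpW).1 (by rwa [e.left_inv hpe])
  have hWn := hr.isOpen.mem_nhds hpW
  obtain ⟨G, hG, hdG, hG0, hGr⟩ := exists_holomorphic_flattening (hr.analytic _ hpW) hr0
    (hr.gradient_ne_zero _ hpW hr0) (by filter_upwards [hWn] with z hz using hL z hz)
  obtain ⟨Ψ, hpΨ, hΨO, hΨ0, hΨG, hΨ, hΨ'⟩ := exists_straightening hn hG hdG hG0
    (inter_mem hWn hGr)
  refine ⟨e.trans Ψ, ⟨(isHolomorphicChart_chartAt p).trans hΨ hΨ', ?_⟩, ⟨hpe, hpΨ⟩, hΨ0⟩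
  intro x hx
  have hx' : e x ∈ W ∧ (r (e x) = 0 ↔ (G (e x)).im = 0) := hΨO hx.2
  change x ∈ M ↔ (Ψ (e x)).2.im = 0
  rw [hΨG, ← hx'.2, ← hr.mem_iff _ hx'.1, e.left_inv hx.1]

/-- Flat charts can be shrunk to flat charts onto the unit polydisc. -/
theorem IsFlatChart.exists_polydisc {M : Set X}
    {Φ : OpenPartialHomeomorph X (FoliatedSpace n)} (hΦ : IsFlatChart M Φ) {p : X}
    (hp : p ∈ Φ.source) (hp0 : Φ p = 0) {O : Set X} (hO : O ∈ 𝓝 p) :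
    ∃ φ : OpenPartialHomeomorph X (FoliatedSpace n), IsFlatChart M φ ∧ p ∈ φ.source ∧
      φ.source ⊆ O ∧
      φ.target = Metric.ball (0 : Fin (n - 1) → ℂ) 1 ×ˢ Metric.ball (0 : ℂ) 1 ∧
      ∃ c : ℝ, ∀ x ∈ φ.source, (φ x).2 = c * (Φ x).2 := by
  have hcont : ContinuousAt Φ.symm 0 := by
    rw [← hp0]; exact Φ.symm.continuousAt (Φ.map_source hp)
  have hO' : Φ.target ∩ Φ.symm ⁻¹' O ∈ 𝓝 (0 : FoliatedSpace n) := by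
    refine inter_mem (Φ.open_target.mem_nhds (by rw [← hp0]; exact Φ.map_source hp))
      (hcont.preimage_mem_nhds ?_)
    rwa [← hp0, Φ.left_inv hp]
  obtain ⟨δ, hδ, hball⟩ := Metric.mem_nhds_iff.1 hO'
  have hδ' : (δ⁻¹ : ℂ) ≠ 0 := by simpa using hδ.ne'
  -- The dilation factor is real, so `Im y = 0` is preserved; balls are polydiscs because the norm
  -- is a maximum.
  let s : FoliatedSpace n ≃ₜ FoliatedSpace n := Homeomorph.smulOfNeZero (δ⁻¹ : ℂ) hδ'
  let Ψ : OpenPartialHomeomorph (FoliatedSpace n) (FoliatedSpace n) :=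
    (OpenPartialHomeomorph.ofSet (Metric.ball 0 δ) Metric.isOpen_ball).trans
      s.toOpenPartialHomeomorph
  have hΨ : ∀ z, Ψ z = (δ⁻¹ : ℂ) • z := fun z => rfl
  have hΨ' : ∀ z, Ψ.symm z = (δ⁻¹ : ℂ)⁻¹ • z := fun z => rfl
  have hΨs : Ψ.source = Metric.ball 0 δ := by simp [Ψ]
  have hΨt : Ψ.target = Metric.ball 0 1 := by
    ext z
    have : z ∈ Ψ.target ↔ (δ⁻¹ : ℂ)⁻¹ • z ∈ Metric.ball (0 : FoliatedSpace n) δ := by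
      rw [← hΨ', ← hΨs]
      refine ⟨fun h => Ψ.map_target h, fun h => ⟨mem_univ _, ?_⟩⟩
      rw [hΨs, hΨ'] at h
      exact h
    rw [this]
    simp only [inv_inv, mem_ball_zero_iff, norm_smul, Complex.norm_real,
      Real.norm_eq_abs, abs_of_pos hδ]
    rw [mul_lt_iff_lt_one_right hδ]
  have hc1 : ContDiffOn ℂ ω Ψ Ψ.source := by
    have : ContDiff ℂ ω (fun z : FoliatedSpace n => (δ⁻¹ : ℂ) • z) := contDiff_const_smul _
    exact this.contDiffOn
  have hc2 : ContDiffOn ℂ ω Ψ.symm Ψ.target := by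
    have : ContDiff ℂ ω (fun z : FoliatedSpace n => (δ⁻¹ : ℂ)⁻¹ • z) := contDiff_const_smul _
    exact this.contDiffOn
  have hval : ∀ x, ((Φ.trans Ψ) x).2 = ((δ⁻¹ : ℝ) : ℂ) * (Φ x).2 := by
    intro x
    change (Ψ (Φ x)).2 = _
    rw [hΨ]; simp
  refine ⟨Φ.trans Ψ, ⟨hΦ.toIsHolomorphicChart.trans hc1 hc2, ?_⟩, ?_, ?_, ?_, δ⁻¹,
    fun x _ => hval x⟩
  · intro x hx
    rw [hΦ.mem_iff x hx.1, hval, Complex.im_ofReal_mul, mul_eq_zero]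
    simp [hδ.ne']
  · refine ⟨hp, ?_⟩
    change Φ p ∈ Ψ.source
    rw [hΨs, hp0]
    exact Metric.mem_ball_self hδ
  · intro x hx
    have h1 : Φ x ∈ Ψ.source := hx.2
    rw [hΨs] at h1
    have := (hball h1).2
    rwa [mem_preimage, Φ.left_inv hx.1] at this
  · rw [OpenPartialHomeomorph.trans_target, hΨt, ball_prod_same]
    refine inter_eq_left.2 fun z hz => ?_
    rw [← hΨt] at hz
    have := Ψ.map_target hz
    rw [hΨs] at this
    exact (hball this).1

/-- On a flat polydisc chart `ψ` contained in the source of a flat chart `Φ`, the last coordinate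
of `Φ` is a holomorphic function of the last coordinate of `ψ`. -/
theorem IsFlatChart.exists_eq_comp_snd {M : Set X}
    {Φ ψ : OpenPartialHomeomorph X (FoliatedSpace n)} (hΦ : IsFlatChart M Φ)
    (hψ : IsFlatChart M ψ) (hsub : ψ.source ⊆ Φ.source)
    (ht : ψ.target = Metric.ball (0 : Fin (n - 1) → ℂ) 1 ×ˢ Metric.ball (0 : ℂ) 1) :
    ∃ h : ℂ → ℂ, DifferentiableOn ℂ h (Metric.ball 0 1) ∧
      ∀ x ∈ ψ.source, (Φ x).2 = h (ψ x).2 := by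
  set F : FoliatedSpace n → ℂ := fun z => (Φ (ψ.symm z)).2 with hF
  have hFd : DifferentiableOn ℂ F ψ.target := by
    have h1 := (hψ.toIsHolomorphicChart.contDiffOn_comp_symm
      hΦ.toIsHolomorphicChart).differentiableOn (by simp)
    exact (h1.snd).mono fun z hz => ⟨hz, hsub (ψ.map_target hz)⟩
  have hmem : ∀ {x y}, x ∈ Metric.ball (0 : Fin (n - 1) → ℂ) 1 → y ∈ Metric.ball (0 : ℂ) 1 →
      (x, y) ∈ ψ.target := by
    intro x y hx hy
    rw [ht]; exact ⟨hx, hy⟩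
  have h0 : (0 : Fin (n - 1) → ℂ) ∈ Metric.ball (0 : Fin (n - 1) → ℂ) 1 :=
    Metric.mem_ball_self one_pos
  have hdy : ∀ x ∈ Metric.ball (0 : Fin (n - 1) → ℂ) 1,
      DifferentiableOn ℂ (fun y => F (x, y)) (Metric.ball 0 1) := fun x hx =>
    hFd.comp (by fun_prop) fun y hy => hmem hx hy
  refine ⟨fun y => F (0, y), hdy 0 h0, fun x hx => ?_⟩
  -- The plaque over a real `t` lies in `M`, so `F (·, t)` is real-valued and holomorphic on a ball,
  -- hence constant. The identity theorem in `y` then reaches non-real `y`.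
  have hreal : ∀ x ∈ Metric.ball (0 : Fin (n - 1) → ℂ) 1, ∀ t : ℝ,
      (t : ℂ) ∈ Metric.ball (0 : ℂ) 1 → F (x, t) = F (0, t) := by
    intro x hx t ht'
    refine eq_of_im_eq_zero (f := fun x => F (x, (t : ℂ))) Metric.isOpen_ball
      (convex_ball (0 : Fin (n - 1) → ℂ) 1).isPreconnected ?_ ?_ hx h0
    · exact hFd.comp (by fun_prop) fun x hx => hmem hx ht'
    · intro x' hx'
      have h1 := hmem hx' ht'
      have h2 := ψ.map_target h1
      rw [← hΦ.mem_iff _ (hsub h2), hψ.mem_iff _ h2, ψ.right_inv h1]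
      simp
  have hall : ∀ x ∈ Metric.ball (0 : Fin (n - 1) → ℂ) 1, ∀ y ∈ Metric.ball (0 : ℂ) 1,
      F (x, y) - F (0, y) = 0 := fun x hx =>
    eq_zero_of_eq_zero_ofReal one_pos ((hdy x hx).sub (hdy 0 h0)) fun t ht' =>
      sub_eq_zero.2 (hreal x hx t ht')
  have h1 := ψ.map_source hx
  have h2 := h1
  rw [ht] at h2
  have h3 := sub_eq_zero.1 (hall _ h2.1 _ h2.2)
  simp only [Prod.mk.eta] at h3
  refine Eq.trans ?_ h3
  simp [hF, ψ.left_inv hx]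

/-- If the last coordinate of `φ` is locally a holomorphic function of the last coordinate of `ψ`,
then the converse holds as well. -/
theorem exists_transition {φ ψ : OpenPartialHomeomorph X (FoliatedSpace n)}
    (hφ : IsHolomorphicChart n φ) (hψ : IsHolomorphicChart n ψ) {x : X} (hxφ : x ∈ φ.source)
    (hxψ : x ∈ ψ.source) {h : ℂ → ℂ} (hh : AnalyticAt ℂ h (ψ x).2)
    (heq : ∀ᶠ y in 𝓝 x, (φ y).2 = h (ψ y).2) :
    ∃ h₂ : ℂ → ℂ, ∀ᶠ z in 𝓝 (φ x), (ψ (φ.symm z)).2 = h₂ z.2 := by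
  set K : FoliatedSpace n → ℂ := fun z => (ψ (φ.symm z)).2 with hK
  have hKx : K (φ x) = (ψ x).2 := by simp [hK, φ.left_inv hxφ]
  have hKd : DifferentiableAt ℂ K (φ x) :=
    (hφ.analyticAt_comp_symm hψ hxφ hxψ).differentiableAt.snd
  have hsymm : Tendsto φ.symm (𝓝 (φ x)) (𝓝 x) := by
    have := φ.symm.continuousAt (φ.map_source hxφ)
    rwa [ContinuousAt, φ.left_inv hxφ] at this
  have hhK : ∀ᶠ z in 𝓝 (φ x), h (K z) = z.2 := by
    filter_upwards [hsymm.eventually heq, φ.open_target.mem_nhds (φ.map_source hxφ)] with z h1 h2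
    rw [φ.right_inv h2] at h1
    exact h1.symm
  have hh' : HasStrictDerivAt h (deriv h (K (φ x))) (K (φ x)) := by
    rw [hKx]; exact hh.hasStrictDerivAt
  -- `h ∘ K` is the last coordinate, whose differential is not zero, so `h` has a local inverse.
  have hne : deriv h (K (φ x)) ≠ 0 := by
    intro h0
    have h1 : HasFDerivAt (h ∘ K) _ (φ x) := hh'.hasDerivAt.hasFDerivAt.comp (φ x) hKd.hasFDerivAt
    have h2 : HasFDerivAt (h ∘ K) (ContinuousLinearMap.snd ℂ (Fin (n - 1) → ℂ) ℂ) (φ x) :=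
      hasFDerivAt_snd.congr_of_eventuallyEq hhK
    have h3 := congrArg (fun A => A ((0, 1) : FoliatedSpace n)) (h1.unique h2)
    simp [h0] at h3
  refine ⟨hh'.localInverse h _ _ hne, ?_⟩
  have hinv := hh'.eventually_left_inverse hne
  filter_upwards [hKd.continuousAt.eventually hinv, hhK] with z h1 h2
  rw [← h2, h1]

end Charts

/-! ### Comparison of the leaves -/

section Leaves

variable {n : ℕ} {X : Type*} [TopologicalSpace X] [ChartedSpace (Cn n) X]
  [IsManifold 𝓘(ℂ, Cn n) ω X] {M : Set X} {φ : OpenPartialHomeomorph X (FoliatedSpace n)}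

/-- The level sets of the last coordinate of a holomorphic chart are complex hypersurfaces. -/
theorem IsHolomorphicChart.isComplexHypersurface (hφ : IsHolomorphicChart n φ) (y : ℂ) :
    IsComplexHypersurface n {x | x ∈ φ.source ∧ (φ x).2 = y} := by
  rintro p ⟨hp, hpy⟩
  set e := chartAt (Cn n) p with he
  have hpe : p ∈ e.source := mem_chart_source _ p
  have hec : IsHolomorphicChart n e := isHolomorphicChart_chartAt p
  have hd := (hec.contDiffOn_comp_symm hφ).differentiableOn (by simp)
  have hopen := e.isOpen_inter_preimage_symm φ.open_source
  refine ⟨e.target ∩ e.symm ⁻¹' φ.source, fun z => (φ (e.symm z)).2 - y, hopen, inter_subset_left,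
    ⟨e.map_source hpe, by simpa [e.left_inv hpe] using hp⟩, hd.snd.sub_const y, ?_, ?_⟩
  -- Read back in the chart `φ`, the defining function is `w.2 - y`, whose differential is nonzero.
  · rintro z ⟨hz, hzφ⟩ - h0
    set x := e.symm z with hx
    have hxe : x ∈ e.source := e.map_target hz
    have hex : e x = z := e.right_inv hz
    have h1 : DifferentiableAt ℂ (fun z => (φ (e.symm z)).2 - y) (e (φ.symm (φ x))) := by
      rw [φ.left_inv hzφ, hex]
      exact (hd.snd.sub_const y).differentiableAt (hopen.mem_nhds ⟨hz, hzφ⟩)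
    have h2 := (hφ.analyticAt_comp_symm hec hzφ hxe).differentiableAt
    have h3 := h1.hasFDerivAt.comp (φ x) h2.hasFDerivAt
    have h4 : HasFDerivAt (fun w : FoliatedSpace n => w.2 - y)
        (ContinuousLinearMap.snd ℂ (Fin (n - 1) → ℂ) ℂ) (φ x) := hasFDerivAt_snd.sub_const y
    have hφx : φ x ∈ φ.target ∩ φ.symm ⁻¹' e.source :=
      ⟨φ.map_source hzφ, by rw [mem_preimage, φ.left_inv hzφ]; exact hxe⟩
    have h5 : ((fun z => (φ (e.symm z)).2 - y) ∘ fun w => e (φ.symm w)) =ᶠ[𝓝 (φ x)]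
        fun w => w.2 - y := by
      filter_upwards [(φ.isOpen_inter_preimage_symm e.open_source).mem_nhds hφx] with w hw
      simp [e.left_inv hw.2, φ.right_inv hw.1]
    have h6 := congrArg (fun A => A ((0, 1) : FoliatedSpace n))
      (h3.unique (h4.congr_of_eventuallyEq h5))
    rw [φ.left_inv hzφ, hex, h0] at h6
    simp at h6
  · rintro z ⟨hz, hzφ⟩
    rw [sub_eq_zero]
    exact ⟨fun h => h.2, fun h => ⟨hzφ, h⟩⟩

/-- Plaques of a flat polydisc chart which meet `M` are contained in leaves of the Levi
foliation. -/
theorem IsFlatChart.leviPlaqueRel (hφ : IsFlatChart M φ)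
    (ht : φ.target = Metric.ball (0 : Fin (n - 1) → ℂ) 1 ×ˢ Metric.ball (0 : ℂ) 1) {a b : X}
    (ha : a ∈ φ.source) (hb : b ∈ φ.source) (hab : (φ a).2 = (φ b).2) (haM : a ∈ M) :
    LeviPlaqueRel n M a b := by
  refine ⟨{x | x ∈ φ.source ∧ (φ x).2 = (φ a).2}, ?_,
    hφ.toIsHolomorphicChart.isComplexHypersurface _, ?_, ⟨ha, rfl⟩, ⟨hb, hab.symm⟩⟩
  · rintro x ⟨hx, hxa⟩
    rw [hφ.mem_iff x hx, hxa, ← hφ.mem_iff a ha]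
    exact haM
  · have ha' := φ.map_source ha
    rw [ht] at ha'
    have himg : {x | x ∈ φ.source ∧ (φ x).2 = (φ a).2} =
        φ.symm '' (Metric.ball (0 : Fin (n - 1) → ℂ) 1 ×ˢ {(φ a).2}) := by
      ext x
      constructor
      · rintro ⟨hx, hxa⟩
        have hx' := φ.map_source hx
        rw [ht] at hx'
        exact ⟨φ x, ⟨hx'.1, hxa⟩, φ.left_inv hx⟩
      · rintro ⟨z, ⟨hz1, hz2⟩, rfl⟩
        have hz : z ∈ φ.target := by
          rw [ht]
          exact ⟨hz1, by rw [mem_singleton_iff.1 hz2]; exact ha'.2⟩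
        exact ⟨φ.map_target hz, by rw [φ.right_inv hz]; exact hz2⟩
    rw [himg]
    have hconn : IsConnected (Metric.ball (0 : Fin (n - 1) → ℂ) 1 ×ˢ {(φ a).2}) :=
      ((convex_ball _ _).isConnected ⟨0, Metric.mem_ball_self one_pos⟩).prod isConnected_singleton
    refine hconn.image _ (φ.symm.continuousOn.mono ?_)
    rintro z ⟨hz1, hz2⟩
    change z ∈ φ.target
    rw [ht]
    exact ⟨hz1, by rw [mem_singleton_iff.1 hz2]; exact ha'.2⟩

/-- A complex hypersurface contained in `M` lies locally in a plaque of a flat chart. -/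
theorem IsFlatChart.eventually_snd_eq (hφ : IsFlatChart M φ) {S : Set X} (hSM : S ⊆ M)
    (hS : IsComplexHypersurface n S) {s : X} (hs : s ∈ S) (hsφ : s ∈ φ.source) :
    ∀ᶠ x in 𝓝[S] s, x ∈ φ.source ∧ (φ x).2 = (φ s).2 := by
  obtain ⟨W, f, hW, hWt, hsW, hf, hdf, hfS⟩ := hS s hs
  set e := chartAt (Cn n) s with he
  have hse : s ∈ e.source := mem_chart_source _ s
  have hec : IsHolomorphicChart n e := isHolomorphicChart_chartAt s
  have hf0 : f (e s) = 0 := (hfS _ hsW).1 (by rwa [e.left_inv hse])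
  obtain ⟨v, hv⟩ : ∃ v, fderiv ℂ f (e s) v ≠ 0 := by
    by_contra! hc
    exact hdf _ hsW hf0 (ContinuousLinearMap.ext hc)
  have hfc := (contDiffOn_one_of_differentiableOn hW hf).contDiffAt (hW.mem_nhds hsW)
  obtain ⟨T, hTc, hT0, hT⟩ := exists_implicit_along one_ne_zero hfc hf0 hv
  set P : Cn n → Cn n := fun z => z + T z • v with hP
  have hPc : Tendsto P (𝓝 (e s)) (𝓝 (e s)) := by
    have : ContinuousAt P (e s) :=
      continuousAt_id.add (hTc.continuousAt.smul continuousAt_const)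
    simpa [ContinuousAt, hP, hT0] using this
  have hopen := e.isOpen_inter_preimage_symm φ.open_source
  have hmem : e s ∈ e.target ∩ e.symm ⁻¹' φ.source :=
    ⟨e.map_source hse, by simpa [e.left_inv hse] using hsφ⟩
  have hd := ((hec.contDiffOn_comp_symm hφ.toIsHolomorphicChart).differentiableOn (by simp)).snd
  have hev : ∀ᶠ z in 𝓝 (e s), DifferentiableAt ℂ T z ∧
      P z ∈ e.target ∩ e.symm ⁻¹' φ.source ∧ P z ∈ W ∧ f (P z) = 0 := by
    filter_upwards [hTc.eventually (by simp), hPc.eventually (hopen.mem_nhds hmem),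
      hPc.eventually (hW.mem_nhds hsW),
      eventually_apply_implicit_along hTc.continuousAt hT0 hT] with z h1 h2 h3 h4
    exact ⟨h1.differentiableAt one_ne_zero, h2, h3, h4⟩
  obtain ⟨δ, hδ, hball⟩ := Metric.eventually_nhds_iff_ball.1 hev
  -- `P` retracts a ball onto `S`, so `g` is holomorphic on an open set although `φ` is only sampled
  -- on `S`. It is real because `S ⊆ M`, hence constant.
  set g : Cn n → ℂ := fun z => (φ (e.symm (P z))).2 with hg
  have hgd : DifferentiableOn ℂ g (Metric.ball (e s) δ) := by
    intro z hz
    obtain ⟨h1, h2, -, -⟩ := hball z hz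
    refine DifferentiableAt.differentiableWithinAt ?_
    have h3 : DifferentiableAt ℂ P z := differentiableAt_id.add (h1.smul_const v)
    exact (hd.differentiableAt (hopen.mem_nhds h2)).comp z h3
  have hgim : ∀ z ∈ Metric.ball (e s) δ, (g z).im = 0 := by
    intro z hz
    obtain ⟨-, h2, h3, h4⟩ := hball z hz
    exact (hφ.mem_iff _ h2.2).1 (hSM ((hfS _ h3).2 h4))
  have hec' : Tendsto e (𝓝 s) (𝓝 (e s)) := e.continuousAt hse
  have hnear : ∀ᶠ x in 𝓝 s, x ∈ φ.source ∧ x ∈ e.source ∧ e x ∈ W ∧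
      e x ∈ Metric.ball (e s) δ ∧ (f (e x) = 0 ↔ T (e x) = 0) := by
    filter_upwards [φ.open_source.mem_nhds hsφ, e.open_source.mem_nhds hse,
      hec'.eventually (hW.mem_nhds hsW), hec'.eventually (Metric.ball_mem_nhds _ hδ),
      hec'.eventually (eventually_eq_zero_iff_implicit_along hT)] with x h1 h2 h3 h4 h5
    exact ⟨h1, h2, h3, h4, h5⟩
  filter_upwards [nhdsWithin_le_nhds hnear, self_mem_nhdsWithin] with x hx hxS
  obtain ⟨h1, h2, h3, h4, h5⟩ := hx
  refine ⟨h1, ?_⟩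
  have hTx : T (e x) = 0 := h5.1 ((hfS _ h3).1 (by rwa [e.left_inv h2]))
  have hgx : g (e x) = (φ x).2 := by simp [hg, hP, hTx, e.left_inv h2]
  have hgs : g (e s) = (φ s).2 := by simp [hg, hP, hT0, e.left_inv hse]
  rw [← hgx, ← hgs]
  exact eq_of_im_eq_zero Metric.isOpen_ball (convex_ball _ _).isPreconnected hgd hgim h4
    (Metric.mem_ball_self hδ)

/-- A foliation by flat charts extends the Levi foliation. -/
theorem HolomorphicFoliation.extendsLeviFoliation {V : Set X} (F : HolomorphicFoliation n V)
    (hMV : M ⊆ V) (hF : ∀ φ ∈ F.charts, IsFlatChart M φ) : F.ExtendsLeviFoliation M := by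
  have hrel : ∀ {a b}, F.PlaqueRel a b → (a ∈ M ↔ b ∈ M) ∧ (a ∈ M → LeviPlaqueRel n M a b) := by
    rintro a b ⟨φ, hφ, ha, hb, hab⟩
    refine ⟨?_, (hF φ hφ).leviPlaqueRel (F.target_eq φ hφ) ha hb hab⟩
    rw [(hF φ hφ).mem_iff a ha, (hF φ hφ).mem_iff b hb, hab]
  have hgen : ∀ {a b}, Relation.EqvGen F.PlaqueRel a b →
      (a ∈ M ↔ b ∈ M) ∧ (a ∈ M → Relation.EqvGen (LeviPlaqueRel n M) a b) := by
    intro a b h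
    induction h with
    | rel a b h => exact ⟨(hrel h).1, fun ha => .rel _ _ ((hrel h).2 ha)⟩
    | refl a => exact ⟨Iff.rfl, fun _ => .refl _⟩
    | symm a b _ ih => exact ⟨ih.1.symm, fun hb => (ih.2 (ih.1.2 hb)).symm⟩
    | trans a b c _ _ ih₁ ih₂ =>
      exact ⟨ih₁.1.trans ih₂.1, fun ha => (ih₁.2 ha).trans _ _ _ (ih₂.2 (ih₁.1.1 ha))⟩
  have hlevi : ∀ {a b}, LeviPlaqueRel n M a b → Relation.EqvGen F.PlaqueRel a b := by
    rintro a b ⟨S, hSM, hS, hSc, ha, hb⟩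
    -- Near each of its points `S` lies in one plaque; connectedness propagates the equivalence over
    -- all of `S`.
    refine hSc.isPreconnected.induction₂ (Relation.EqvGen F.PlaqueRel) (fun s hs => ?_)
      (fun x y z _ _ _ => Relation.EqvGen.trans x y z) (fun x y _ _ => Relation.EqvGen.symm x y)
      ha hb
    obtain ⟨φ, hφ, hsφ⟩ := F.cover s (hMV (hSM hs))
    filter_upwards [(hF φ hφ).eventually_snd_eq hSM hS hs hsφ] with x hx
    exact .rel _ _ ⟨φ, hφ, hsφ, hx.1, hx.2.symm⟩
  have hgen' : ∀ {a b}, Relation.EqvGen (LeviPlaqueRel n M) a b →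
      Relation.EqvGen F.PlaqueRel a b := by
    intro a b h
    induction h with
    | rel a b h => exact hlevi h
    | refl a => exact .refl _
    | symm a b _ ih => exact ih.symm
    | trans a b c _ _ ih₁ ih₂ => exact ih₁.trans _ _ _ ih₂
  exact fun p hp => Set.ext fun q => ⟨fun h => (hgen h).2 hp, hgen'⟩

end Leaves

/-! ### Gluing the flat charts -/

/-- A Levi-flat real analytic hypersurface is covered by flat polydisc charts whose last
coordinates are functions of one another on overlaps. -/
theorem exists_foliation_of_isLeviFlat {n : ℕ} (hn : 1 ≤ n) {X : Type*} [TopologicalSpace X]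
    [T2Space X] [SecondCountableTopology X] [ChartedSpace (Cn n) X]
    [IsManifold 𝓘(ℂ, Cn n) ω X] {M : Set X} (hM : IsLeviFlat n M) :
    ∃ V : Set X, IsOpen V ∧ M ⊆ V ∧
      ∃ F : HolomorphicFoliation n V, ∀ φ ∈ F.charts, IsFlatChart M φ := by
  have : LocallyCompactSpace X := ChartedSpace.locallyCompactSpace (Cn n) X
  have : TopologicalSpace.MetrizableSpace X :=
    TopologicalSpace.metrizableSpace_of_t3_secondCountable X
  let _ : MetricSpace X := TopologicalSpace.metrizableSpaceMetric X
  choose Φ hΦ hpΦ hΦ0 using fun p : M => exists_isFlatChart hn hM p.2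
  choose ε hε hεΦ using fun p : M => Metric.isOpen_iff.1 (Φ p).open_source p (hpΦ p)
  choose φ hφ hpφ hφε hφt c hc using fun p : M =>
    (hΦ p).exists_polydisc (hpΦ p) (hΦ0 p)
      (Metric.ball_mem_nhds (p : X) (div_pos (hε p) three_pos))
  -- The overlap itself may miss `M`, so the comparison is made on the whole polydisc at `q`. It
  -- lies in the large chart at `p`, since `ε q / 3 + ε q / 3 + ε p / 3 ≤ ε p`.
  have key : ∀ p q : M, ε q ≤ ε p → ((φ p).source ∩ (φ q).source).Nonempty →
      ∃ h : ℂ → ℂ, DifferentiableOn ℂ h (Metric.ball 0 1) ∧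
        ∀ x ∈ (φ p).source ∩ (φ q).source, (φ p x).2 = h (φ q x).2 := by
    rintro p q hle ⟨x, hxp, hxq⟩
    have hsub : (φ q).source ⊆ (Φ p).source := by
      intro y hy
      refine hεΦ p ?_
      have h1 := Metric.mem_ball.1 (hφε p hxp)
      have h2 := Metric.mem_ball'.1 (hφε q hxq)
      have h3 := Metric.mem_ball.1 (hφε q hy)
      rw [Metric.mem_ball]
      have h4 := dist_triangle4 y q x p
      linarith
    obtain ⟨h, hh, heq⟩ := (hΦ p).exists_eq_comp_snd (hφ q) hsub (hφt q)
    refine ⟨fun y => c p * h y, hh.const_mul _, fun y hy => ?_⟩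
    rw [hc p y hy.1, heq y hy.2]
  refine ⟨⋃ p : M, (φ p).source, isOpen_iUnion fun p => (φ p).open_source,
    fun p hp => mem_iUnion.2 ⟨⟨p, hp⟩, hpφ ⟨p, hp⟩⟩, ?_⟩
  refine ⟨{
    charts := range φ
    source_subset := ?_
    cover := ?_
    target_eq := ?_
    holomorphic := ?_
    holomorphic_symm := ?_
    transition := ?_ }, ?_⟩
  · rintro _ ⟨p, rfl⟩
    exact subset_iUnion (fun p => (φ p).source) p
  · intro x hx
    obtain ⟨p, hx⟩ := mem_iUnion.1 hx
    exact ⟨φ p, mem_range_self p, hx⟩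
  · rintro _ ⟨p, rfl⟩
    exact hφt p
  · rintro _ ⟨p, rfl⟩
    exact (hφ p).holomorphic
  · rintro _ ⟨p, rfl⟩
    exact (hφ p).holomorphic_symm
  · rintro _ ⟨p, rfl⟩ _ ⟨q, rfl⟩ x ⟨hxp, hxq⟩
    -- `key` expresses the last coordinate of the chart with larger `ε` through the other one. One
    -- case therefore needs the local inverse from `exists_transition`, and the other is immediate.
    rcases le_total (ε q) (ε p) with hle | hle
    · obtain ⟨h, hh, heq⟩ := key p q hle ⟨x, hxp, hxq⟩
      have hxt := (φ q).map_source hxq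
      rw [hφt q] at hxt
      refine exists_transition (hφ p).toIsHolomorphicChart (hφ q).toIsHolomorphicChart
        hxp hxq (hh.analyticAt (Metric.isOpen_ball.mem_nhds hxt.2)) ?_
      filter_upwards [(φ p).open_source.mem_nhds hxp, (φ q).open_source.mem_nhds hxq]
        with y h1 h2 using heq y ⟨h1, h2⟩
    · obtain ⟨h, -, heq⟩ := key q p hle ⟨x, hxq, hxp⟩
      refine ⟨h, ?_⟩
      filter_upwards [((φ p).isOpen_inter_preimage_symm (φ q).open_source).mem_nhds
        ⟨(φ p).map_source hxp, by rwa [mem_preimage, (φ p).left_inv hxp]⟩] with z hz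
      rw [heq _ ⟨hz.2, (φ p).map_target hz.1⟩, (φ p).right_inv hz.1]
  · rintro _ ⟨p, rfl⟩
    exact hφ p

end LeviFlat

end

theorem mainTheorem3 (n : ℕ) (hn : 2 ≤ n)
    {X : Type*} [TopologicalSpace X] [T2Space X] [SecondCountableTopology X]
    [ChartedSpace (LeviFlat.Cn n) X] [IsManifold 𝓘(ℂ, LeviFlat.Cn n) ω X]
    (M : Set X) (hM : LeviFlat.IsRealAnalyticHypersurface n M)
    (hflat : LeviFlat.IsLeviFlat n M) :
    ∃ V : Set X, IsOpen V ∧ M ⊆ V ∧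
      ∃ F : LeviFlat.HolomorphicFoliation n V, F.ExtendsLeviFoliation M := by
  obtain ⟨V, hV, hMV, F, hF⟩ := LeviFlat.exists_foliation_of_isLeviFlat (by omega) hflat
  exact ⟨V, hV, hMV, F, F.extendsLeviFoliation hMV hF⟩
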